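/- Let $N\ge 2$, let $l^2(\mathbb Z^+)$ be the Hilbert space of square summable complex sequences $(x_k)_{k\ge 0}$, and for $0\le i<N$ let $S_i$ be the isometry of $l^2(\mathbb Z^+)$ given by $(S_ix)_k=x_r$ if $k=rN+i$ and $(S_ix)_k=0$ otherwise. For a multi-index $l=(l_1,\dots,l_k)$ put $S_l=S_{l_1}\cdots S_{l_k}$, $|l|=k$ (and $S_\emptyset=I$). Let $\mathcal O_N\subseteq L(l^2(\mathbb Z^+))$ be the (concrete Cuntz) $C^*$-algebra generated by $S_0,\dots,S_{N-1}$, and let $\mathcal O_N^{par}$ be the closed subalgebra generated by all $S_lS_m^*$ with $|l|=|m|$. On $l^2(\mathbb Z^+,l^2(\mathbb Z^+))$ let $\Sigma_i$ be the operator $(\Sigma_i x)_n=S_ix_{n+1}$, i.e. the infinite block matrix with $S_i$ on the first diagonal above the main diagonal and zeros elsewhere. Let $\mathcal T_N$ be the smallest closed subalgebra of $L(l^2(\mathbb Z^+,l^2(\mathbb Z^+)))$ which contains all $\Sigma_i$ and $\Sigma_i^*$, and let $\mathcal C_N$ be the smallest closed ideal of $\mathcal T_N$ which contains the projection $\Pi_1=\mathrm{diag}(I,0,0,\dots)$.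 (i) For each $\lambda\in\mathbb T$ there is a unique $*$-automorphism $\rho_\lambda$ of $\mathcal O_N$ with $\rho_\lambda(S_i)=\bar\lambda S_i$ for all $i$, and there is a unique bounded linear map $\Phi_0$ on $\mathcal O_N$ such that $\Phi_0(A)=A_0$ for every finite sum $A=\sum_{k<0}(S_0^*)^{-k}A_k+A_0+\sum_{k>0}A_kS_0^k$ with all $A_k\in\mathcal O_N^{par}$. (ii) For each $A\in\mathcal O_N$ the function $f_A:\mathbb T\to\mathcal O_N$, $f_A(\lambda)=\rho_\lambda(A)$, is continuous. With its Fourier coefficients $a_k=\int_{\mathbb T}f_A(\lambda)\lambda^{-k}\,d\lambda$ (normalized Haar measure), the Toeplitz matrix $(a_{i-j})_{i,j\ge0}$ defines a bounded operator $T(f_A)$ on $l^2(\mathbb Z^+,l^2(\mathbb Z^+))$, the matrix $\big((S_0^*)^i\,\Phi_0(S_0^iA(S_0^*)^j)\,S_0^j\big)_{i,j\ge 0}$ defines a bounded operator $\Psi(A)$ on the same space, and $T(f_A)=\Psi(A)$. (iii) The set $\{T(f_A):A\in\mathcal O_N\}=\{\Psi(A):A\in\mathcal O_N\}$ is a closed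 linear subspace, and $$\mathcal T_N=\{T(f_A):A\in\mathcal O_N\}\oplus\mathcal C_N=\{\Psi(A):A\in\mathcal O_N\}\oplus\mathcal C_N$$ as a direct sum of linear spaces. (iv) Let $V$ be the forward shift on $l^2(\mathbb Z,l^2(\mathbb Z^+))$, $(Vx)_{m+1}=x_m$, let $V_n=V^n$, and identify $l^2(\mathbb Z^+,l^2(\mathbb Z^+))$ with a closed subspace of $l^2(\mathbb Z,l^2(\mathbb Z^+))$ via extension by zero (operators on the subspace being extended by zero on its orthogonal complement). For every $B\in\mathcal T_N$ the strong limit $W(B)=\text{s-}\lim_{n\to+\infty}V_n^*BV_n$ exists, $W$ is a $*$-homomorphism on $\mathcal T_N$, and $\ker W=\mathcal C_N$. -/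

import Mathlib

open Filter Topology

open scoped ComplexConjugate

noncomputable section

namespace StratToeplitz

/-- `l²(ι, E)`: square summable families indexed by `ι` with entries in `E`. -/
abbrev L2 (ι E : Type*) [NormedAddCommGroup E] : Type _ := lp (fun _ : ι => E) 2

/-- The Hilbert space `l²(ℤ⁺)`. -/
abbrev H : Type := L2 ℕ ℂ

/-- The Hilbert space `l²(ℤ⁺, l²(ℤ⁺))`. -/
abbrev HH : Type := L2 ℕ H

/-- The Hilbert space `l²(ℤ, l²(ℤ⁺))`. -/
abbrev HZ : Type := L2 ℤ H

section Relabel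

theorem memlp_extend {ι κ E : Type*} [NormedAddCommGroup E] (φ : ι ↪ κ) (x : L2 ι E) :
    Memℓp (E := fun _ : κ => E) (Function.extend φ x 0) 2 := by
  have hp : 0 < (2 : ENNReal).toReal := by norm_num
  rw [memℓp_gen_iff hp]
  have h := (memℓp_gen_iff hp).1 (lp.memℓp x)
  refine (φ.injective.summable_iff ?_).1 ?_
  · intro k hk
    rw [Function.extend_apply' _ _ _ (by simpa using hk)]
    simp
  · simpa [Function.comp_def, φ.injective.extend_apply] using h

variable {ι κ E : Type*} [NormedAddCommGroup E] [InnerProductSpace ℂ E]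

/-- For an injection `φ : ι → κ`, the isometry `l²(ι, E) → l²(κ, E)` which moves the `r`-th
entry to position `φ r` and puts `0` at the positions outside the range of `φ`. -/
def relabel (φ : ι ↪ κ) : L2 ι E →ₗᵢ[ℂ] L2 κ E where
  toFun x := ⟨Function.extend φ x 0, memlp_extend φ x⟩
  map_add' x y := by
    ext k
    by_cases hk : ∃ r, φ r = k
    · obtain ⟨r, rfl⟩ := hk
      refine (φ.injective.extend_apply _ _ _).trans ?_
      exact (congrArg₂ (· + ·) (φ.injective.extend_apply x 0 r)
        (φ.injective.extend_apply y 0 r)).symm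
    · refine (Function.extend_apply' _ _ _ hk).trans ?_
      have h : ∀ z : L2 ι E, Function.extend φ z (0 : κ → E) k = 0 :=
        fun z => Function.extend_apply' _ _ _ hk
      exact ((congrArg₂ (· + ·) (h x) (h y)).trans (add_zero 0)).symm
  map_smul' c x := by
    ext k
    by_cases hk : ∃ r, φ r = k
    · obtain ⟨r, rfl⟩ := hk
      simp [φ.injective.extend_apply]
    · simp [Function.extend_apply' _ _ _ hk]
  norm_map' x := by
    have hp : 0 < (2 : ENNReal).toReal := by norm_num
    rw [lp.norm_eq_tsum_rpow hp, lp.norm_eq_tsum_rpow hp]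
    congr 1
    change ∑' k, ‖Function.extend φ x 0 k‖ ^ (2 : ENNReal).toReal = _
    rw [← φ.injective.tsum_eq]
    · simp [φ.injective.extend_apply]
    · intro k hk
      by_contra hk'
      apply hk
      change ‖Function.extend φ x 0 k‖ ^ (2 : ENNReal).toReal = 0
      rw [Function.extend_apply' _ _ _ (by simpa using hk')]
      simp

theorem relabel_apply (φ : ι ↪ κ) (x : L2 ι E) (r : ι) : relabel φ x (φ r) = x r :=
  φ.injective.extend_apply _ _ _

theorem relabel_apply_of_notMem (φ : ι ↪ κ) (x : L2 ι E) (k : κ) (hk : ¬ ∃ r, φ r = k) :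
    relabel φ x k = 0 :=
  Function.extend_apply' _ _ _ hk

end Relabel

section Cuntz

variable (N : ℕ) [NeZero N]

/-- The injection `r ↦ r N + i` of `ℕ`. -/
def affineEmb (i : Fin N) : ℕ ↪ ℕ where
  toFun r := r * N + i
  inj' _ _ h := Nat.eq_of_mul_eq_mul_right (Nat.pos_of_neZero N) (Nat.add_right_cancel h)

/-- The isometry `S_i` on `l²(ℤ⁺)`: `(S_i x)_k = x_r` if `k = r N + i`, and `0` otherwise. -/
def S (i : Fin N) : H →L[ℂ] H := (relabel (affineEmb N i)).toContinuousLinearMap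

/-- The concrete Cuntz algebra `O_N`: the smallest `C*`-subalgebra of `L(l²(ℤ⁺))` which
contains the operators `S_i`. -/
def cuntzAlg : StarSubalgebra ℂ (H →L[ℂ] H) :=
  (StarAlgebra.adjoin ℂ (Set.range (S N))).topologicalClosure

/-- `S_i` as an element of `O_N`. -/
def gen (i : Fin N) : cuntzAlg N :=
  ⟨S N i, StarSubalgebra.le_topologicalClosure _
    (StarAlgebra.subset_adjoin ℂ _ (Set.mem_range_self i))⟩

/-- `S_l = S_{l_1} ⋯ S_{l_k}` for a multi-index `l`; the empty product is `I`. -/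
def word (l : List (Fin N)) : H →L[ℂ] H := (l.map (S N)).prod

/-- `O_N^par`: the smallest closed subalgebra which contains all products `S_l S_m^*` with
multi-indices `l` and `m` of the same length. (This set of products is closed under adjoints,
so the generated closed subalgebra is the generated closed *-subalgebra.) -/
def parAlg : StarSubalgebra ℂ (H →L[ℂ] H) :=
  (StarAlgebra.adjoin ℂ {A | ∃ l m : List (Fin N), l.length = m.length ∧
    A = word N l * star (word N m)}).topologicalClosure

/-- The `k`-th term of a Fourier expansion of an element of `O_N`: it is `(S_0^*)^{-k} a` for
`k < 0` and `a S_0^k` for `k ≥ 0`. -/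
def fourierTerm (k : ℤ) (a : H →L[ℂ] H) : H →L[ℂ] H :=
  if k < 0 then star (S N 0) ^ (-k).toNat * a else a * S N 0 ^ k.toNat

/-- `Φ` is a bounded linear map on `O_N` which sends every finite sum
`A = ∑_{k < 0} (S_0^*)^{-k} A_k + A_0 + ∑_{k > 0} A_k S_0^k` with coefficients `A_k` in `O_N^par`
to its zeroth coefficient `A_0`. These sums are dense in `O_N`, so there is at most one such
`Φ`. -/
def IsZerothCoeff (Φ : cuntzAlg N →L[ℂ] (H →L[ℂ] H)) : Prop :=
  ∀ (A : cuntzAlg N) (s : Finset ℤ) (a : ℤ → (H →L[ℂ] H)), 0 ∈ s → (∀ k, a k ∈ parAlg N) →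
    (A : H →L[ℂ] H) = ∑ k ∈ s, fourierTerm N k (a k) → Φ A = a 0

open Classical in
/-- The expectation `Φ₀ : O_N → O_N^par`, the continuous extension of the map which takes the
zeroth Fourier coefficient. -/
def expectation : cuntzAlg N →L[ℂ] (H →L[ℂ] H) :=
  if h : ∃ Φ, IsZerothCoeff N Φ then h.choose else 0

/-- `ρ` is the automorphism of `O_N` with `ρ(S_i) = conj(z) S_i` for all `i`. -/
def IsGauge (z : Circle) (ρ : cuntzAlg N ≃⋆ₐ[ℂ] cuntzAlg N) : Prop :=
  ∀ i : Fin N, ρ (gen N i) = conj (z : ℂ) • gen N i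

open Classical in
/-- The automorphism `ρ_z` of `O_N` which is determined by `ρ_z(S_i) = conj(z) S_i`. -/
def gauge (z : Circle) : cuntzAlg N ≃⋆ₐ[ℂ] cuntzAlg N :=
  if h : ∃ ρ, IsGauge N z ρ then h.choose else StarAlgEquiv.refl ℂ _

/-- The function `f_A : 𝕋 → O_N ⊆ L(l²(ℤ⁺))`, `z ↦ ρ_z(A)`. -/
def symb (A : cuntzAlg N) (z : Circle) : H →L[ℂ] H := gauge N z A

end Cuntz

section Block

/-- The bounded operator `T` on `l²(ℤ⁺, l²(ℤ⁺))` has the block matrix `(M i j)_{i, j ≥ 0}`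
(`i` is the row and `j` the column). -/
def HasBlockMatrix (T : HH →L[ℂ] HH) (M : ℕ → ℕ → (H →L[ℂ] H)) : Prop :=
  ∀ (i j : ℕ) (x : H), T (lp.single 2 j x) i = M i j x

open Classical in
/-- The bounded operator on `l²(ℤ⁺, l²(ℤ⁺))` with a given block matrix (and `0` if the matrix does
not define a bounded operator). -/
def blockOp (M : ℕ → ℕ → (H →L[ℂ] H)) : HH →L[ℂ] HH :=
  if h : ∃ T, HasBlockMatrix T M then h.choose else 0

/-- The Fourier coefficient `a_k = ∫ a(z) z^{-k} dz` with respect to the normalized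
Haar measure of the circle, which is parametrized as `ℝ / ℤ`. -/
def coeff (a : Circle → (H →L[ℂ] H)) (k : ℤ) : H →L[ℂ] H :=
  fourierCoeff (T := (1 : ℝ)) (fun t : AddCircle (1 : ℝ) => a (AddCircle.toCircle t)) k

/-- The Toeplitz matrix `(a_{i-j})_{i, j ≥ 0}` of a function `a` on the circle. -/
def toeplitzMatrix (a : Circle → (H →L[ℂ] H)) (i j : ℕ) : H →L[ℂ] H :=
  coeff a ((i : ℤ) - (j : ℤ))

/-- The Toeplitz operator `T(a)` on `l²(ℤ⁺, l²(ℤ⁺))`. -/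
def toeplitzOp (a : Circle → (H →L[ℂ] H)) : HH →L[ℂ] HH := blockOp (toeplitzMatrix a)

variable (N : ℕ) [NeZero N]

/-- The matrix with entries `(S_0^*)^i Φ₀(S_0^i A (S_0^*)^j) S_0^j`. -/
def psiMatrix (A : cuntzAlg N) (i j : ℕ) : H →L[ℂ] H :=
  star (S N 0) ^ i * expectation N (gen N 0 ^ i * A * star (gen N 0) ^ j) * S N 0 ^ j

/-- The operator `Ψ(A)` on `l²(ℤ⁺, l²(ℤ⁺))`. -/
def psi (A : cuntzAlg N) : HH →L[ℂ] HH := blockOp (psiMatrix N A)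

/-- The injection `n ↦ n + 1` of `ℕ`. -/
def succEmb : ℕ ↪ ℕ := ⟨Nat.succ, Nat.succ_injective⟩

/-- The forward shift `(x_0, x_1, …) ↦ (0, x_0, x_1, …)` on `l²(ℤ⁺, l²(ℤ⁺))`. -/
def fshift : HH →L[ℂ] HH := (relabel succEmb).toContinuousLinearMap

/-- The diagonal operator `diag(A, A, A, …)` on `l²(ℤ⁺, l²(ℤ⁺))`. -/
def ampl (A : H →L[ℂ] H) : HH →L[ℂ] HH :=
  lp.mapCLM 2 (fun _ : ℕ => A) (K := ‖A‖) (norm_nonneg A) (fun _ => le_rfl)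

/-- The operator `Σ_i`, whose block matrix has `S_i` on the first diagonal above the main
diagonal and zeros elsewhere: `(Σ_i x)_n = S_i x_{n+1}`. -/
def Sig (i : Fin N) : HH →L[ℂ] HH := ampl (S N i) * star fshift

/-- The algebra `T_N`: the smallest closed subalgebra of `L(l²(ℤ⁺, l²(ℤ⁺)))` which contains all
operators `Σ_i` and `Σ_i^*`. -/
def toepAlg : StarSubalgebra ℂ (HH →L[ℂ] HH) :=
  (StarAlgebra.adjoin ℂ (Set.range (Sig N))).topologicalClosure

/-- The projection `Π_1 = diag(I, 0, 0, …)`. -/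
def Pi1 : HH →L[ℂ] HH :=
  (lp.singleContinuousLinearMap ℂ (fun _ : ℕ => H) 2 0).comp
    (lp.evalCLM ℂ (fun _ : ℕ => H) 2 0)

/-- `J` is a closed (two-sided) ideal of `T_N`. -/
def IsClosedIdeal (J : Submodule ℂ (HH →L[ℂ] HH)) : Prop :=
  (∀ x ∈ J, x ∈ toepAlg N) ∧ IsClosed (J : Set (HH →L[ℂ] HH)) ∧
    ∀ a ∈ toepAlg N, ∀ x ∈ J, a * x ∈ J ∧ x * a ∈ J

/-- `C_N`: the smallest closed ideal of `T_N` which contains `Π_1`. -/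
def idealC : Submodule ℂ (HH →L[ℂ] HH) :=
  sInf {J | IsClosedIdeal N J ∧ Pi1 ∈ J}

/-- The inclusion of `l²(ℤ⁺, l²(ℤ⁺))` into `l²(ℤ, l²(ℤ⁺))` (extension by zero); its adjoint is
the orthogonal projection onto `l²(ℤ⁺, l²(ℤ⁺))`. -/
def incl : HH →L[ℂ] HZ := (relabel ⟨Nat.cast, Nat.cast_injective⟩).toContinuousLinearMap

/-- The forward shift `V` on `l²(ℤ, l²(ℤ⁺))`: `(V x)_{m+1} = x_m`. -/
def V : HZ →L[ℂ] HZ := (relabel ⟨fun m : ℤ => m + 1, add_left_injective 1⟩).toContinuousLinearMap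

/-- The operator `V_n^* B V_n`, where `V_n = V^n` and `B` acts on `l²(ℤ⁺, l²(ℤ⁺))`, considered as
a subspace of `l²(ℤ, l²(ℤ⁺))`. -/
def shifted (B : HH →L[ℂ] HH) (n : ℕ) : HZ →L[ℂ] HZ :=
  star (V ^ n) * (incl ∘L B ∘L ContinuousLinearMap.adjoint incl) * V ^ n

end Block

end StratToeplitz

end

noncomputable section

namespace StratToeplitz

/-! Everything is read off from one faithful representation `π` (`laurentRep`) of `O_N` on `l²(ℤ,
l²(ℤ⁺))`, with `π(S_i) = S_i ⊗ V^*`. The operators `T(f_A)` and `Ψ(A)` both turn out to be the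
compression of `π(A)` to the half line.

The homomorphisms come from asymptotic intertwining. If contractions `J_n` are asymptotically
isometric and `A J_n - J_n B → 0` strongly, together with adjoints, then `‖B‖ ≤ ‖A‖` and `B` is
determined by `A`. Hence `A ↦ B` extends from generators to a contractive `*`-homomorphism of the
generated `C*`-algebra (`exists_starAlgHom_asympIntertwines`). Three choices of `J_n` are used.
Embeddings into far-out basis vectors of `l²(ℤ⁺)` give `π`; averages over approximate eigenvectors
of `V^*` give the evaluation `S_i ⊗ V^* ↦ z S_i`; truncations of `V^n` give `W` with `W(Σ_i) =
π(S_i)`. Evaluation after `π` yields the gauge automorphisms, and at `z = 1` it shows that `π` is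
isometric.

On `S_l S_m^*` the number `|m| - |l|` is both the exponent of `f_A` and the displacement caused by
`π`. As these elements span a dense subspace, the blocks of `π(A)` are the Fourier coefficients of
`f_A`, and `Φ₀(A)` is the block at `(0, 0)`.

Write `T(A)` for the compression. Since `W(T(A)) = π(A)`, the map `T` is isometric, so its range is
closed and meets `ker W` only in `0`. Left multiplication by `Σ_i` or `Σ_i^*` preserves `T(O_N) +
C_N`, because the only defect is a multiple of `Π_1`. An approximation argument then gives `ker W =
C_N`, and the decomposition follows. -/

set_option linter.unusedSectionVars false

/-! ### Asymptotic intertwining and the homomorphisms it induces -/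

section Asymptotic

variable {E F : Type*} [NormedAddCommGroup E] [InnerProductSpace ℂ E] [CompleteSpace E]
  [NormedAddCommGroup F] [InnerProductSpace ℂ F] [CompleteSpace F]

/-- A sequence of contractions which is asymptotically isometric on each vector. -/
structure AsympIsometric (J : ℕ → F →L[ℂ] E) : Prop where
  norm_apply_le : ∀ n x, ‖J n x‖ ≤ ‖x‖
  tendsto_norm : ∀ x, Tendsto (fun n => ‖J n x‖) atTop (𝓝 ‖x‖)

/-- `A J_n - J_n B` and `A^* J_n - J_n B^*` converge strongly to `0`. -/
structure AsympIntertwines (J : ℕ → F →L[ℂ] E) (A : E →L[ℂ] E) (B : F →L[ℂ] F) : Prop where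
  tendsto : ∀ x, Tendsto (fun n => A (J n x) - J n (B x)) atTop (𝓝 0)
  tendsto_star : ∀ x, Tendsto (fun n => star A (J n x) - J n (star B x)) atTop (𝓝 0)

namespace AsympIntertwines

variable {J : ℕ → F →L[ℂ] E} {A A' : E →L[ℂ] E} {B B' : F →L[ℂ] F}

theorem adjoint (h : AsympIntertwines J A B) : AsympIntertwines J (star A) (star B) :=
  ⟨h.tendsto_star, by simpa using h.tendsto⟩

theorem add (h : AsympIntertwines J A B) (h' : AsympIntertwines J A' B') :
    AsympIntertwines J (A + A') (B + B') := by
  constructor <;> intro x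
  · have := (h.tendsto x).add (h'.tendsto x)
    rw [add_zero] at this
    refine this.congr fun n => ?_
    simp only [add_apply, map_add]
    abel
  · have := (h.tendsto_star x).add (h'.tendsto_star x)
    rw [add_zero] at this
    refine this.congr fun n => ?_
    simp only [star_add, add_apply, map_add]
    abel

theorem smul (c : ℂ) (h : AsympIntertwines J A B) : AsympIntertwines J (c • A) (c • B) := by
  constructor <;> intro x
  · have := (h.tendsto x).const_smul c
    rw [smul_zero] at this
    refine this.congr fun n => ?_
    simp only [smul_apply, map_smul, smul_sub]
  · have := (h.tendsto_star x).const_smul (star c)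
    rw [smul_zero] at this
    refine this.congr fun n => ?_
    simp only [star_smul, smul_apply, map_smul, smul_sub]

theorem sub (h : AsympIntertwines J A B) (h' : AsympIntertwines J A' B') :
    AsympIntertwines J (A - A') (B - B') := by
  simpa [sub_eq_add_neg] using h.add (h'.smul (-1))

theorem tendsto_mul (h : ∀ x, Tendsto (fun n => A (J n x) - J n (B x)) atTop (𝓝 0))
    (h' : ∀ x, Tendsto (fun n => A' (J n x) - J n (B' x)) atTop (𝓝 0)) (x : F) :
    Tendsto (fun n => (A * A') (J n x) - J n ((B * B') x)) atTop (𝓝 0) := by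
  have h1 := (A.continuous.tendsto 0).comp (h' x)
  have h2 := h1.add (h (B' x))
  rw [map_zero, add_zero] at h2
  refine h2.congr fun n => ?_
  simp only [Function.comp_apply, map_sub, mul_apply_eq_comp]
  abel

theorem mul (h : AsympIntertwines J A B) (h' : AsympIntertwines J A' B') :
    AsympIntertwines J (A * A') (B * B') :=
  ⟨tendsto_mul h.tendsto h'.tendsto, by
    rw [star_mul, star_mul]
    exact tendsto_mul h'.tendsto_star h.tendsto_star⟩

theorem one : AsympIntertwines J 1 1 := by
  constructor <;> intro x <;> simp

theorem of_algebraMap (c : ℂ) :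
    AsympIntertwines J (algebraMap ℂ (E →L[ℂ] E) c) (algebraMap ℂ (F →L[ℂ] F) c) := by
  rw [Algebra.algebraMap_eq_smul_one, Algebra.algebraMap_eq_smul_one]
  exact one.smul c

/-- `‖J_n B x‖` tends to `‖B x‖` and exceeds `‖A J_n x‖ ≤ ‖A‖ ‖x‖` by at most a null sequence.
Uniqueness of `B` and continuity of `A ↦ B` both rest on this estimate. -/
theorem norm_le (hJ : AsympIsometric J) (h : AsympIntertwines J A B) : ‖B‖ ≤ ‖A‖ := by
  refine ContinuousLinearMap.opNorm_le_bound _ (norm_nonneg _) fun x => ?_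
  have h1 : Tendsto (fun n => ‖A (J n x) - J n (B x)‖ + ‖A‖ * ‖x‖) atTop (𝓝 (0 + ‖A‖ * ‖x‖)) :=
    (tendsto_zero_iff_norm_tendsto_zero.1 (h.tendsto x)).add_const _
  rw [zero_add] at h1
  refine le_of_tendsto_of_tendsto' (hJ.tendsto_norm (B x)) h1 fun n => ?_
  have h2 : ‖J n (B x)‖ ≤ ‖A (J n x) - J n (B x)‖ + ‖A (J n x)‖ := by
    rw [norm_sub_rev]
    exact norm_le_norm_sub_add _ _
  have h3 : ‖A (J n x)‖ ≤ ‖A‖ * ‖x‖ :=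
    (A.le_opNorm _).trans (by gcongr; exact hJ.norm_apply_le n x)
  linarith

theorem unique (hJ : AsympIsometric J) (h : AsympIntertwines J A B)
    (h' : AsympIntertwines J A B') : B = B' := by
  have := norm_le hJ (h.sub h')
  rw [sub_self, norm_zero] at this
  exact sub_eq_zero.1 (norm_le_zero_iff.1 this)

theorem tendsto_of_tendsto (hJ : AsympIsometric J) {a : ℕ → E →L[ℂ] E} {b : ℕ → F →L[ℂ] F}
    (ha : Tendsto a atTop (𝓝 A)) (hb : Tendsto b atTop (𝓝 B))
    (h : ∀ k x, Tendsto (fun n => a k (J n x) - J n (b k x)) atTop (𝓝 0)) (x : F) :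
    Tendsto (fun n => A (J n x) - J n (B x)) atTop (𝓝 0) := by
  rw [Metric.tendsto_atTop]
  intro ε hε
  have h1 : Tendsto (fun k => ‖A - a k‖ * ‖x‖ + ‖b k - B‖ * ‖x‖) atTop (𝓝 0) := by
    have ha' : Tendsto (fun k => ‖A - a k‖) atTop (𝓝 0) := by
      simpa using (ha.const_sub A).norm
    have hb' : Tendsto (fun k => ‖b k - B‖) atTop (𝓝 0) := by
      simpa using (hb.sub_const B).norm
    simpa using (ha'.mul_const ‖x‖).add (hb'.mul_const ‖x‖)
  -- As all `J_n` are contractions, one `k` controls both approximation errors uniformly in `n`.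
  obtain ⟨k, hk⟩ := (h1.eventually_lt_const (half_pos hε)).exists
  obtain ⟨n₀, hn₀⟩ := Metric.tendsto_atTop.1 (h k x) _ (half_pos hε)
  refine ⟨n₀, fun n hn => ?_⟩
  have h2 := hn₀ n hn
  rw [dist_zero_right] at h2 ⊢
  have h3 : A (J n x) - J n (B x) =
      (A - a k) (J n x) + (a k (J n x) - J n (b k x)) + J n ((b k - B) x) := by
    simp only [sub_apply, map_sub]
    abel
  have h4 : ‖(A - a k) (J n x)‖ ≤ ‖A - a k‖ * ‖x‖ :=
    ((A - a k).le_opNorm _).trans (by gcongr; exact hJ.norm_apply_le n x)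
  have h5 : ‖J n ((b k - B) x)‖ ≤ ‖b k - B‖ * ‖x‖ :=
    (hJ.norm_apply_le n _).trans ((b k - B).le_opNorm _)
  rw [h3]
  have := norm_add₃_le (a := (A - a k) (J n x)) (b := a k (J n x) - J n (b k x))
    (c := J n ((b k - B) x))
  linarith

theorem of_tendsto (hJ : AsympIsometric J) {a : ℕ → E →L[ℂ] E} {b : ℕ → F →L[ℂ] F}
    (ha : Tendsto a atTop (𝓝 A)) (hb : Tendsto b atTop (𝓝 B))
    (h : ∀ k, AsympIntertwines J (a k) (b k)) : AsympIntertwines J A B :=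
  ⟨tendsto_of_tendsto hJ ha hb fun k => (h k).tendsto,
    tendsto_of_tendsto hJ ha.star hb.star fun k => (h k).tendsto_star⟩

end AsympIntertwines

/-- The operators which are asymptotically intertwined with some operator. -/
def intertwinedAlg (J : ℕ → F →L[ℂ] E) : StarSubalgebra ℂ (E →L[ℂ] E) where
  carrier := {A | ∃ B, AsympIntertwines J A B}
  mul_mem' := fun ⟨_, h⟩ ⟨_, h'⟩ => ⟨_, h.mul h'⟩
  add_mem' := fun ⟨_, h⟩ ⟨_, h'⟩ => ⟨_, h.add h'⟩
  algebraMap_mem' c := ⟨_, AsympIntertwines.of_algebraMap c⟩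
  star_mem' := fun ⟨_, h⟩ => ⟨_, h.adjoint⟩

theorem isClosed_intertwinedAlg {J : ℕ → F →L[ℂ] E} (hJ : AsympIsometric J) :
    IsClosed (intertwinedAlg J : Set (E →L[ℂ] E)) := by
  refine isClosed_of_closure_subset fun A hA => ?_
  obtain ⟨a, ha, hlim⟩ := mem_closure_iff_seq_limit.1 hA
  choose b hb using ha
  -- Differences of the `b k` are intertwined with differences of the `a k`, so `norm_le` transfers
  -- the Cauchy property.
  have hcauchy : CauchySeq b := by
    rw [Metric.cauchySeq_iff]
    intro ε hε
    obtain ⟨n₀, hn₀⟩ := Metric.cauchySeq_iff.1 hlim.cauchySeq ε hε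
    refine ⟨n₀, fun m hm n hn => lt_of_le_of_lt ?_ (hn₀ m hm n hn)⟩
    rw [dist_eq_norm, dist_eq_norm]
    exact ((hb m).sub (hb n)).norm_le hJ
  obtain ⟨B, hB⟩ := cauchySeq_tendsto_of_complete hcauchy
  exact ⟨B, AsympIntertwines.of_tendsto hJ hlim hB hb⟩

/-- If all elements of `G` are asymptotically intertwined with operators on `F`, then this
correspondence extends to a `*`-homomorphism of the `C*`-algebra generated by `G`. -/
theorem exists_starAlgHom_asympIntertwines {J : ℕ → F →L[ℂ] E} (hJ : AsympIsometric J)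
    {G : Set (E →L[ℂ] E)} (hG : ∀ A ∈ G, ∃ B, AsympIntertwines J A B) :
    ∃ Θ : (StarAlgebra.adjoin ℂ G).topologicalClosure →⋆ₐ[ℂ] (F →L[ℂ] F),
      ∀ A : (StarAlgebra.adjoin ℂ G).topologicalClosure,
        AsympIntertwines J (A : E →L[ℂ] E) (Θ A) := by
  have hle : (StarAlgebra.adjoin ℂ G).topologicalClosure ≤ intertwinedAlg J :=
    StarSubalgebra.topologicalClosure_minimal (StarAlgebra.adjoin_le hG)
      (isClosed_intertwinedAlg hJ)
  choose Θ hΘ using fun A : (StarAlgebra.adjoin ℂ G).topologicalClosure => hle A.2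
  exact ⟨{
    toFun := Θ
    map_one' := (hΘ 1).unique hJ AsympIntertwines.one
    map_mul' := fun A A' => (hΘ (A * A')).unique hJ ((hΘ A).mul (hΘ A'))
    map_zero' := (hΘ 0).unique hJ (by simpa using AsympIntertwines.of_algebraMap (J := J) 0)
    map_add' := fun A A' => (hΘ (A + A')).unique hJ ((hΘ A).add (hΘ A'))
    commutes' := fun c => (hΘ (algebraMap ℂ _ c)).unique hJ (AsympIntertwines.of_algebraMap c)
    map_star' := fun A => (hΘ (star A)).unique hJ (hΘ A).adjoint }, hΘ⟩

theorem continuous_of_asympIntertwines {J : ℕ → F →L[ℂ] E} (hJ : AsympIsometric J)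
    {U : StarSubalgebra ℂ (E →L[ℂ] E)} {Θ : U →⋆ₐ[ℂ] (F →L[ℂ] F)}
    (hΘ : ∀ A : U, AsympIntertwines J (A : E →L[ℂ] E) (Θ A)) : Continuous Θ :=
  AddMonoidHomClass.continuous_of_bound Θ 1 fun A => by
    rw [one_mul]
    exact (hΘ A).norm_le hJ

end Asymptotic

/-! ### From generators to generated closed `*`-algebras -/

section Generation

variable {A B : Type*} [NormedRing A] [NormedAlgebra ℂ A] [StarRing A] [StarModule ℂ A]
  [ContinuousStar A] [NormedRing B] [NormedAlgebra ℂ B] [StarRing B] [StarModule ℂ B]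
  [ContinuousStar B]

/-- A generator as an element of the generated closed `*`-subalgebra. -/
def closureGen {G : Set A} {a : A} (ha : a ∈ G) :
    (StarAlgebra.adjoin ℂ G).topologicalClosure :=
  ⟨a, StarSubalgebra.le_topologicalClosure _ (StarAlgebra.subset_adjoin ℂ _ ha)⟩

theorem starAlgHom_mem_of_generators {G : Set A}
    (f : (StarAlgebra.adjoin ℂ G).topologicalClosure →⋆ₐ[ℂ] B) (hf : Continuous f)
    {U : StarSubalgebra ℂ B} (hU : IsClosed (U : Set B))
    (h : ∀ a (ha : a ∈ G), f (closureGen ha) ∈ U)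
    (x : (StarAlgebra.adjoin ℂ G).topologicalClosure) : f x ∈ U := by
  have h1 : ∀ y (hy : y ∈ StarAlgebra.adjoin ℂ G),
      f ⟨y, StarSubalgebra.le_topologicalClosure _ hy⟩ ∈ U := by
    intro y hy
    induction hy using StarAlgebra.adjoin_induction with
    | mem y hy => exact h y hy
    | algebraMap r => exact (f.commutes r).symm ▸ U.algebraMap_mem r
    | add y z hy hz ihy ihz => exact (map_add f ⟨y, _⟩ ⟨z, _⟩).symm ▸ U.add_mem ihy ihz
    | mul y z hy hz ihy ihz => exact (map_mul f ⟨y, _⟩ ⟨z, _⟩).symm ▸ U.mul_mem ihy ihz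
    | star y hy ih => exact (map_star f ⟨y, _⟩).symm ▸ star_mem ih
  obtain ⟨x, hx⟩ := x
  obtain ⟨u, hu, hlim⟩ := mem_closure_iff_seq_limit.1 hx
  refine hU.mem_of_tendsto (hf.continuousAt.tendsto.comp
    (f := fun n => (⟨u n, StarSubalgebra.le_topologicalClosure _ (hu n)⟩ :
      (StarAlgebra.adjoin ℂ G).topologicalClosure)) (tendsto_subtype_rng.2 hlim)) ?_
  exact Eventually.of_forall fun n => h1 _ (hu n)

theorem starAlgHom_ext_of_generators {G : Set A}
    {f g : (StarAlgebra.adjoin ℂ G).topologicalClosure →⋆ₐ[ℂ] B} (hf : Continuous f)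
    (hg : Continuous g) (h : ∀ a (ha : a ∈ G), f (closureGen ha) = g (closureGen ha)) :
    f = g := by
  refine StarAlgHom.ext_topologicalClosure hf hg ?_
  refine StarAlgHom.ext_adjoin ?_
  rintro ⟨x, hx'⟩ hx
  exact h x hx

/-- Since `f` lives only on `V`, the induction carries along a lift to `V` of each element of the
generated algebra. This serves to compare `π` on `O_N^par` with amplification, which is defined on
all operators. -/
theorem starAlgHom_eq_of_generators {G : Set A} {V : StarSubalgebra ℂ A} {f : V →⋆ₐ[ℂ] B}
    {g : A →⋆ₐ[ℂ] B} (hf : Continuous f) (hg : Continuous g)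
    (h : ∀ a ∈ G, ∃ b : V, (b : A) = a ∧ f b = g a) (x : V)
    (hx : (x : A) ∈ (StarAlgebra.adjoin ℂ G).topologicalClosure) : f x = g x := by
  have h1 : ∀ y ∈ StarAlgebra.adjoin ℂ G, ∃ b : V, (b : A) = y ∧ f b = g y := by
    intro y hy
    induction hy using StarAlgebra.adjoin_induction with
    | mem y hy => exact h y hy
    | algebraMap r =>
      exact ⟨algebraMap ℂ V r, rfl, (f.commutes r).trans (g.commutes r).symm⟩
    | add y z _ _ ihy ihz =>
      obtain ⟨b, rfl, hb⟩ := ihy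
      obtain ⟨c, rfl, hc⟩ := ihz
      exact ⟨b + c, rfl, by rw [map_add f, map_add g, hb, hc]⟩
    | mul y z _ _ ihy ihz =>
      obtain ⟨b, rfl, hb⟩ := ihy
      obtain ⟨c, rfl, hc⟩ := ihz
      exact ⟨b * c, rfl, by rw [map_mul f, map_mul g, hb, hc]⟩
    | star y _ ih =>
      obtain ⟨b, rfl, hb⟩ := ih
      exact ⟨star b, rfl, by rw [map_star f, map_star g, hb]⟩
  obtain ⟨u, hu, hlim⟩ := mem_closure_iff_seq_limit.1 hx
  choose v hv hfv using fun n => h1 (u n) (hu n)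
  have hv' : Tendsto v atTop (𝓝 x) :=
    tendsto_subtype_rng.2 (hlim.congr fun n => (hv n).symm)
  refine tendsto_nhds_unique ((hf.tendsto x).comp hv')
    (((hg.tendsto x).comp hlim).congr fun n => (hfv n).symm)

theorem adjoin_le_of_mul_mem {G : Set A} (Q : Submodule ℂ A) (h1 : 1 ∈ Q)
    (hG : ∀ a ∈ G, ∀ x ∈ Q, a * x ∈ Q ∧ star a * x ∈ Q) {x : A}
    (hx : x ∈ StarAlgebra.adjoin ℂ G) : x ∈ Q := by
  -- The induction runs over left multipliers of `Q`, which form an algebra although `Q` need not;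
  -- `1 ∈ Q` then returns `x` itself.
  have h2 : ∀ y ∈ Q, x * y ∈ Q := by
    change x ∈ (StarAlgebra.adjoin ℂ G).toSubalgebra at hx
    rw [StarAlgebra.adjoin_toSubalgebra] at hx
    induction hx using Algebra.adjoin_induction with
    | mem a ha =>
      rcases ha with ha | ha
      · exact fun y hy => (hG a ha y hy).1
      · exact fun y hy => by simpa using (hG _ ha y hy).2
    | algebraMap r =>
      intro y hy
      rw [← Algebra.smul_def]
      exact Q.smul_mem r hy
    | add a b _ _ iha ihb =>
      intro y hy
      rw [add_mul]
      exact Q.add_mem (iha y hy) (ihb y hy)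
    | mul a b _ _ iha ihb =>
      intro y hy
      rw [mul_assoc]
      exact iha _ (ihb y hy)
  simpa using h2 1 h1

end Generation

/-! ### Basis vectors, relabellings and diagonal operators on `l²` spaces -/

section Sequence

variable {ι κ E F : Type*} [NormedAddCommGroup E] [InnerProductSpace ℂ E]
  [NormedAddCommGroup F] [InnerProductSpace ℂ F]

theorem L2.mem_of_single_mem {Q : Submodule ℂ (L2 ι E)} (hQ : IsClosed (Q : Set (L2 ι E)))
    [DecidableEq ι] (h : ∀ i a, (lp.single 2 i a : L2 ι E) ∈ Q) (x : L2 ι E) : x ∈ Q :=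
  hQ.mem_of_tendsto (lp.hasSum_single (by norm_num) x)
    (Eventually.of_forall fun s => Q.sum_mem fun i _ => h i (x i))

theorem L2.clm_ext [DecidableEq ι] {f g : L2 ι E →L[ℂ] F}
    (h : ∀ i a, f (lp.single 2 i a) = g (lp.single 2 i a)) : f = g := by
  ext x
  exact L2.mem_of_single_mem (Q := (LinearMap.eqLocus f.toLinearMap g.toLinearMap))
    (isClosed_eq f.continuous g.continuous) h x

theorem L2.mem_of_single_single_mem {Q : Submodule ℂ (L2 ι (L2 κ ℂ))} [DecidableEq ι]
    [DecidableEq κ] (hQ : IsClosed (Q : Set (L2 ι (L2 κ ℂ))))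
    (h : ∀ i k, (lp.single 2 i (lp.single 2 k 1) : L2 ι (L2 κ ℂ)) ∈ Q) (x : L2 ι (L2 κ ℂ)) :
    x ∈ Q := by
  refine L2.mem_of_single_mem hQ (fun i a => ?_) x
  let f := lp.singleContinuousLinearMap ℂ (fun _ : ι => L2 κ ℂ) 2 i
  refine L2.mem_of_single_mem (Q := Q.comap f.toLinearMap) (hQ.preimage f.continuous)
    (fun k c => ?_) a
  have : (lp.single 2 k c : L2 κ ℂ) = c • lp.single 2 k 1 := by
    rw [← lp.single_smul, smul_eq_mul, mul_one]
  rw [this]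
  exact Submodule.smul_mem _ c (h i k)

/-- The vectors on which a sequence of operators converges to `0`. -/
def nullSubmodule (u : ℕ → F →L[ℂ] E) : Submodule ℂ F where
  carrier := {x | Tendsto (fun n => u n x) atTop (𝓝 0)}
  add_mem' hx hy := by simpa using hx.add hy
  zero_mem' := by simp
  smul_mem' c x hx := by simpa using hx.const_smul c

theorem isClosed_nullSubmodule {u : ℕ → F →L[ℂ] E} {C : ℝ} (hu : ∀ n x, ‖u n x‖ ≤ C * ‖x‖) :
    IsClosed (nullSubmodule u : Set F) := by
  refine isClosed_of_closure_subset fun x hx => ?_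
  -- No sign is assumed for `C`; `|C| + 1` is a larger constant by which one may divide.
  have hC : 0 < |C| + 1 := by positivity
  refine Metric.tendsto_atTop.2 fun ε hε => ?_
  obtain ⟨y, hy, hxy⟩ := Metric.mem_closure_iff.1 hx (ε / 2 / (|C| + 1)) (by positivity)
  obtain ⟨n₀, hn₀⟩ := Metric.tendsto_atTop.1 hy (ε / 2) (half_pos hε)
  refine ⟨n₀, fun n hn => ?_⟩
  have h1 := hn₀ n hn
  rw [dist_zero_right] at h1 ⊢
  have h2 : ‖u n (x - y)‖ ≤ (|C| + 1) * ‖x - y‖ :=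
    (hu n _).trans (by gcongr; linarith [le_abs_self C])
  rw [dist_eq_norm, lt_div_iff₀ hC] at hxy
  have h3 : u n x = u n (x - y) + u n y := by simp
  rw [h3]
  exact (norm_add_le _ _).trans_lt (by linarith)

theorem relabel_single [DecidableEq ι] [DecidableEq κ] (φ : ι ↪ κ) (r : ι) (a : E) :
    relabel φ (lp.single 2 r a : L2 ι E) = lp.single 2 (φ r) a := by
  ext k
  by_cases hk : ∃ s, φ s = k
  · obtain ⟨s, rfl⟩ := hk
    rw [relabel_apply, lp.single_apply, lp.single_apply]
    by_cases h : s = r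
    · subst h; simp
    · rw [Pi.single_eq_of_ne h, Pi.single_eq_of_ne (φ.injective.ne h)]
  · rw [relabel_apply_of_notMem _ _ _ hk, lp.single_apply, Pi.single_eq_of_ne]
    rintro rfl
    exact hk ⟨r, rfl⟩

theorem inner_single_single [DecidableEq ι] (i j : ι) (a b : E) :
    inner ℂ (lp.single 2 i a : L2 ι E) (lp.single 2 j b) = if i = j then inner ℂ a b else 0 := by
  rw [lp.inner_single_left, lp.single_apply]
  split_ifs with h
  · subst h; simp
  · rw [Pi.single_eq_of_ne h, inner_zero_right]

variable [CompleteSpace E] [CompleteSpace F]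

theorem adjoint_linearIsometry_apply (U : E →ₗᵢ[ℂ] F) (x : E) :
    ContinuousLinearMap.adjoint U.toContinuousLinearMap (U x) = x :=
  congrArg (fun T : E →L[ℂ] E => T x)
    ((ContinuousLinearMap.norm_map_iff_adjoint_comp_self U.toContinuousLinearMap).1 U.norm_map)

theorem adjoint_relabel_apply (φ : ι ↪ κ) (y : L2 κ E) (r : ι) :
    ContinuousLinearMap.adjoint (relabel φ).toContinuousLinearMap y r = y (φ r) := by
  classical
  refine ext_inner_left ℂ fun a => ?_
  have h := ContinuousLinearMap.adjoint_inner_right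
    (relabel φ).toContinuousLinearMap (lp.single 2 r a : L2 ι E) y
  rw [lp.inner_single_left] at h
  rw [h]
  change inner ℂ (relabel φ (lp.single 2 r a)) y = _
  rw [relabel_single, lp.inner_single_left]

theorem adjoint_relabel_single [DecidableEq ι] [DecidableEq κ] (φ : ι ↪ κ) (r : ι) (a : E) :
    ContinuousLinearMap.adjoint (relabel φ).toContinuousLinearMap
      (lp.single 2 (φ r) a : L2 κ E) = lp.single 2 r a := by
  rw [← relabel_single, adjoint_linearIsometry_apply]

theorem adjoint_relabel_single_of_notMem [DecidableEq κ] (φ : ι ↪ κ) (k : κ)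
    (hk : ¬ ∃ r, φ r = k) (a : E) :
    ContinuousLinearMap.adjoint (relabel φ).toContinuousLinearMap
      (lp.single 2 k a : L2 κ E) = 0 := by
  ext r
  rw [adjoint_relabel_apply, lp.single_apply, Pi.single_eq_of_ne fun h => hk ⟨r, h⟩]
  rfl

/-- The diagonal operator on `l²(ι, E)` with all diagonal entries equal to `A`. -/
def diagOp (ι : Type*) (A : E →L[ℂ] E) : L2 ι E →L[ℂ] L2 ι E :=
  lp.mapCLM 2 (fun _ : ι => A) (K := ‖A‖) (norm_nonneg A) (fun _ => le_rfl)

theorem diagOp_apply (A : E →L[ℂ] E) (x : L2 ι E) (i : ι) : diagOp ι A x i = A (x i) := rfl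

theorem norm_diagOp_le (A : E →L[ℂ] E) : ‖diagOp ι A‖ ≤ ‖A‖ :=
  lp.norm_mapCLM_le _ _ (norm_nonneg A) _

theorem diagOp_single [DecidableEq ι] (A : E →L[ℂ] E) (i : ι) (a : E) :
    diagOp ι A (lp.single 2 i a) = lp.single 2 i (A a) := by
  ext j
  rw [diagOp_apply, lp.single_apply, lp.single_apply]
  by_cases h : j = i
  · subst h; simp
  · rw [Pi.single_eq_of_ne h, Pi.single_eq_of_ne h, map_zero]

/-- Amplification as a `*`-homomorphism. -/
def diagHom (ι : Type*) : (E →L[ℂ] E) →⋆ₐ[ℂ] (L2 ι E →L[ℂ] L2 ι E) where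
  toFun := diagOp ι
  map_one' := rfl
  map_mul' _ _ := rfl
  map_zero' := rfl
  map_add' _ _ := rfl
  commutes' _ := rfl
  map_star' A := by
    rw [ContinuousLinearMap.star_eq_adjoint, ContinuousLinearMap.star_eq_adjoint,
      ContinuousLinearMap.eq_adjoint_iff]
    intro x y
    rw [lp.inner_eq_tsum, lp.inner_eq_tsum]
    refine tsum_congr fun i => ?_
    rw [diagOp_apply, diagOp_apply, ContinuousLinearMap.adjoint_inner_left]

theorem star_diagOp (A : E →L[ℂ] E) : star (diagOp ι A) = diagOp ι (star A) :=
  (map_star (diagHom (E := E) ι) A).symm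

theorem diagOp_mul (A B : E →L[ℂ] E) : diagOp ι (A * B) = diagOp ι A * diagOp ι B := rfl

theorem continuous_diagHom : Continuous (diagHom (E := E) ι) :=
  AddMonoidHomClass.continuous_of_bound (diagHom (E := E) ι) 1 fun A => by
    rw [one_mul]
    exact norm_diagOp_le A

theorem adjoint_relabel_diagOp (A : E →L[ℂ] E) (φ : ι ↪ κ) (y : L2 κ E) :
    ContinuousLinearMap.adjoint (relabel φ).toContinuousLinearMap (diagOp κ A y) =
      diagOp ι A (ContinuousLinearMap.adjoint (relabel φ).toContinuousLinearMap y) := by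
  ext r
  rw [adjoint_relabel_apply, diagOp_apply, diagOp_apply, adjoint_relabel_apply]

theorem Orthonormal.exists_linearIsometry [DecidableEq ι] {v : ι → F} (hv : Orthonormal ℂ v) :
    ∃ U : L2 ι ℂ →ₗᵢ[ℂ] F, ∀ i, U (lp.single 2 i 1) = v i := by
  refine ⟨hv.orthogonalFamily.linearIsometry, fun i => ?_⟩
  rw [OrthogonalFamily.linearIsometry_apply_single]
  simp

theorem norm_adjoint_linearIsometry_le (U : E →ₗᵢ[ℂ] F) (x : F) :
    ‖ContinuousLinearMap.adjoint U.toContinuousLinearMap x‖ ≤ ‖x‖ := by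
  refine (ContinuousLinearMap.le_opNorm _ x).trans ?_
  rw [LinearIsometryEquiv.norm_map]
  exact mul_le_of_le_one_left (norm_nonneg _) U.norm_toContinuousLinearMap_le

/-- A contraction which maps one orthonormal family onto another one. -/
theorem exists_contraction_of_orthonormal {v : ι → F} {w : ι → E} (hv : Orthonormal ℂ v)
    (hw : Orthonormal ℂ w) : ∃ T : F →L[ℂ] E, (∀ x, ‖T x‖ ≤ ‖x‖) ∧ (∀ i, T (v i) = w i) ∧
      ∀ i, ContinuousLinearMap.adjoint T (w i) = v i := by
  classical
  obtain ⟨U, hU⟩ := Orthonormal.exists_linearIsometry hv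
  obtain ⟨W, hW⟩ := Orthonormal.exists_linearIsometry hw
  refine ⟨W.toContinuousLinearMap ∘L ContinuousLinearMap.adjoint U.toContinuousLinearMap,
    fun x => ?_, fun i => ?_, fun i => ?_⟩
  · change ‖W _‖ ≤ _
    rw [W.norm_map]
    exact norm_adjoint_linearIsometry_le U x
  · change W _ = _
    rw [← hU]
    exact (congrArg W (adjoint_linearIsometry_apply U _)).trans (hW i)
  · rw [ContinuousLinearMap.adjoint_comp, ContinuousLinearMap.adjoint_adjoint]
    change U _ = _
    rw [← hW]
    exact (congrArg U (adjoint_linearIsometry_apply W _)).trans (hU i)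

end Sequence

/-! ### Orthonormal families and strong convergence tested on basis vectors -/

section Families

variable {ι κ μ E F : Type*} [NormedAddCommGroup E] [InnerProductSpace ℂ E]
  [NormedAddCommGroup F] [InnerProductSpace ℂ F]

theorem orthonormal_single [DecidableEq ι] {f : μ → ι} (hf : Function.Injective f) :
    Orthonormal ℂ (fun i => (lp.single 2 (f i) 1 : L2 ι ℂ)) := by
  classical
  rw [orthonormal_iff_ite]
  intro i j
  rw [inner_single_single]
  simp [hf.eq_iff]

theorem orthonormal_single_single [DecidableEq ι] [DecidableEq κ] {f : μ → ι × κ}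
    (hf : Function.Injective f) :
    Orthonormal ℂ (fun i => (lp.single 2 (f i).1 (lp.single 2 (f i).2 1) : L2 ι (L2 κ ℂ))) := by
  classical
  rw [orthonormal_iff_ite]
  intro i j
  rw [inner_single_single, inner_single_single, ← hf.eq_iff, Prod.ext_iff]
  split_ifs <;> simp_all

variable [CompleteSpace E] [CompleteSpace F]

/-- This is `‖J_n x‖² = ⟨J_n^* J_n x, x⟩ → ⟨x, x⟩`. -/
theorem AsympIsometric.of_adjoint {J : ℕ → F →L[ℂ] E} (h : ∀ n x, ‖J n x‖ ≤ ‖x‖)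
    (h' : ∀ x, Tendsto (fun n => ContinuousLinearMap.adjoint (J n) (J n x)) atTop (𝓝 x)) :
    AsympIsometric J := by
  refine ⟨h, fun x => ?_⟩
  have h1 : Tendsto (fun n => RCLike.re (inner ℂ (ContinuousLinearMap.adjoint (J n) (J n x)) x))
      atTop (𝓝 (RCLike.re (inner ℂ x x))) :=
    (RCLike.continuous_re.tendsto _).comp ((h' x).inner tendsto_const_nhds)
  have h2 := h1.sqrt
  rw [inner_self_eq_norm_sq, Real.sqrt_sq (norm_nonneg _)] at h2
  refine h2.congr fun n => ?_
  rw [ContinuousLinearMap.adjoint_inner_left, inner_self_eq_norm_sq,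
    Real.sqrt_sq (norm_nonneg _)]

theorem norm_le_one_of_apply_le {T : F →L[ℂ] E} (h : ∀ x, ‖T x‖ ≤ ‖x‖) : ‖T‖ ≤ 1 :=
  T.opNorm_le_bound zero_le_one fun x => by simpa using h x

theorem norm_adjoint_apply_le {T : F →L[ℂ] E} (h : ∀ x, ‖T x‖ ≤ ‖x‖) (y : E) :
    ‖ContinuousLinearMap.adjoint T y‖ ≤ ‖y‖ := by
  refine (ContinuousLinearMap.le_opNorm _ y).trans ?_
  rw [LinearIsometryEquiv.norm_map]
  exact mul_le_of_le_one_left (norm_nonneg _) (norm_le_one_of_apply_le h)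

theorem isClosed_nullSubmodule_intertwine {J : ℕ → F →L[ℂ] E} (h : ∀ n x, ‖J n x‖ ≤ ‖x‖)
    (A : E →L[ℂ] E) (B : F →L[ℂ] F) :
    IsClosed (nullSubmodule (fun n => A ∘L J n - J n ∘L B) : Set F) := by
  refine isClosed_nullSubmodule (C := ‖A‖ + ‖B‖) fun n x => ?_
  have h1 : ‖A (J n x)‖ ≤ ‖A‖ * ‖x‖ := (A.le_opNorm _).trans (by gcongr; exact h n x)
  have h2 : ‖J n (B x)‖ ≤ ‖B‖ * ‖x‖ := (h n _).trans (B.le_opNorm _)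
  calc ‖A (J n x) - J n (B x)‖ ≤ ‖A (J n x)‖ + ‖J n (B x)‖ := norm_sub_le _ _
    _ ≤ (‖A‖ + ‖B‖) * ‖x‖ := by linarith

theorem isClosed_nullSubmodule_adjoint {J : ℕ → F →L[ℂ] E} (h : ∀ n x, ‖J n x‖ ≤ ‖x‖) :
    IsClosed (nullSubmodule
      (fun n => ContinuousLinearMap.adjoint (J n) ∘L J n - ContinuousLinearMap.id ℂ F) :
      Set F) := by
  refine isClosed_nullSubmodule (C := 2) fun n x => ?_
  have h1 := (norm_adjoint_apply_le (h n) (J n x)).trans (h n x)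
  calc ‖ContinuousLinearMap.adjoint (J n) (J n x) - x‖
      ≤ ‖ContinuousLinearMap.adjoint (J n) (J n x)‖ + ‖x‖ := norm_sub_le _ _
    _ ≤ 2 * ‖x‖ := by linarith

theorem tendsto_intertwine_of_eventually [DecidableEq ι] [DecidableEq κ]
    {J : ℕ → L2 ι (L2 κ ℂ) →L[ℂ] E} (hJ : ∀ n x, ‖J n x‖ ≤ ‖x‖) {A : E →L[ℂ] E}
    {B : L2 ι (L2 κ ℂ) →L[ℂ] L2 ι (L2 κ ℂ)}
    (h : ∀ i k, ∀ᶠ n in atTop, A (J n (lp.single 2 i (lp.single 2 k 1))) =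
      J n (B (lp.single 2 i (lp.single 2 k 1)))) (x : L2 ι (L2 κ ℂ)) :
    Tendsto (fun n => A (J n x) - J n (B x)) atTop (𝓝 0) := by
  refine L2.mem_of_single_single_mem (isClosed_nullSubmodule_intertwine hJ A B)
    (fun i k => ?_) x
  refine tendsto_const_nhds.congr' ?_
  filter_upwards [h i k] with n hn
  exact (sub_eq_zero.2 hn).symm

end Families

/-! ### The operators `S_i` on basis vectors -/

section Generators

variable (N : ℕ) [NeZero N]

theorem S_single (i : Fin N) (q : ℕ) (c : ℂ) :
    S N i (lp.single 2 q c) = lp.single 2 (q * N + i) c :=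
  relabel_single (affineEmb N i) q c

theorem star_S_single_same (i : Fin N) (q : ℕ) (c : ℂ) :
    star (S N i) (lp.single 2 (q * N + i) c) = lp.single 2 q c :=
  adjoint_relabel_single (affineEmb N i) q c

theorem star_S_single_of_ne {i j : Fin N} (h : i ≠ j) (q : ℕ) (c : ℂ) :
    star (S N i) (lp.single 2 (q * N + j) c) = 0 := by
  refine adjoint_relabel_single_of_notMem (affineEmb N i) _ ?_ c
  rintro ⟨r, hr⟩
  apply h
  change r * N + i = q * N + j at hr
  have := congrArg (· % N) hr
  simp only [Nat.mul_add_mod_self_right, Nat.mod_eq_of_lt i.2, Nat.mod_eq_of_lt j.2] at this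
  exact Fin.ext this

theorem star_S_mul_S (i j : Fin N) : star (S N i) * S N j = if i = j then 1 else 0 := by
  refine L2.clm_ext fun q c => ?_
  rw [mul_apply_eq_comp, S_single]
  split_ifs with h
  · subst h
    rw [star_S_single_same]
    rfl
  · rw [star_S_single_of_ne N h]
    rfl

theorem star_S_mul_S_self (i : Fin N) : star (S N i) * S N i = 1 := by
  rw [star_S_mul_S, if_pos rfl]

end Generators

/-! ### The bilateral shift and the Laurent generators -/

section Shift

theorem V_single (m : ℤ) (x : H) : V (lp.single 2 m x) = lp.single 2 (m + 1) x :=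
  relabel_single (⟨fun m : ℤ => m + 1, add_left_injective 1⟩ : ℤ ↪ ℤ) m x

theorem star_V_single (m : ℤ) (x : H) : star V (lp.single 2 m x) = lp.single 2 (m - 1) x := by
  have := adjoint_relabel_single (⟨fun m : ℤ => m + 1, add_left_injective 1⟩ : ℤ ↪ ℤ) (m - 1) x
  rw [ContinuousLinearMap.star_eq_adjoint]
  rwa [Function.Embedding.coeFn_mk, sub_add_cancel] at this

theorem star_V_mul_V : star V * V = 1 := by
  refine L2.clm_ext fun m x => ?_
  rw [mul_apply_eq_comp, V_single, star_V_single]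
  simp

theorem V_mul_star_V : V * star V = 1 := by
  refine L2.clm_ext fun m x => ?_
  rw [mul_apply_eq_comp, star_V_single, V_single]
  simp

theorem V_pow_single (n : ℕ) (m : ℤ) (x : H) :
    (V ^ n) (lp.single 2 m x) = lp.single 2 (m + n) x := by
  induction n with
  | zero => simp
  | succ n ih =>
    rw [pow_succ', mul_apply_eq_comp, ih, V_single]
    push_cast
    rw [add_assoc]

theorem star_V_pow_single (n : ℕ) (m : ℤ) (x : H) :
    star (V ^ n) (lp.single 2 m x) = lp.single 2 (m - n) x := by
  induction n generalizing m with
  | zero => simp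
  | succ n ih =>
    rw [pow_succ, star_mul, mul_apply_eq_comp, ih, star_V_single]
    push_cast
    rw [sub_add_eq_sub_sub]

theorem norm_V (x : HZ) : ‖V x‖ = ‖x‖ := LinearIsometry.norm_map _ x

theorem norm_V_pow (n : ℕ) (x : HZ) : ‖(V ^ n) x‖ = ‖x‖ := by
  induction n with
  | zero => simp
  | succ n ih => rw [pow_succ', mul_apply_eq_comp, norm_V, ih]

theorem commute_V_diagOp (A : H →L[ℂ] H) : Commute V (diagOp ℤ A) := by
  refine L2.clm_ext fun m x => ?_
  rw [mul_apply_eq_comp, mul_apply_eq_comp, V_single, diagOp_single, diagOp_single, V_single]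

theorem commute_star_V_diagOp (A : H →L[ℂ] H) : Commute (star V) (diagOp ℤ A) := by
  have := (commute_V_diagOp (star A)).star_star
  rwa [star_diagOp, star_star] at this

variable (N : ℕ) [NeZero N]

/-- The generator `S_i ⊗ V^*` of the Laurent operators on `l²(ℤ, l²(ℤ⁺))`. -/
def laurentGen (i : Fin N) : HZ →L[ℂ] HZ := diagOp ℤ (S N i) * star V

theorem star_laurentGen (i : Fin N) : star (laurentGen N i) = diagOp ℤ (star (S N i)) * V := by
  rw [laurentGen, star_mul, star_star, star_diagOp, (commute_V_diagOp _).eq]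

theorem laurentGen_single (i : Fin N) (m : ℤ) (x : H) :
    laurentGen N i (lp.single 2 m x) = lp.single 2 (m - 1) (S N i x) := by
  rw [laurentGen, mul_apply_eq_comp, star_V_single, diagOp_single]

theorem star_laurentGen_single (i : Fin N) (m : ℤ) (x : H) :
    star (laurentGen N i) (lp.single 2 m x) = lp.single 2 (m + 1) (star (S N i) x) := by
  rw [star_laurentGen, mul_apply_eq_comp, V_single, diagOp_single]

end Shift

/-! ### Laurent generators as asymptotic limits of the `S_i` -/

section Compression

variable (N : ℕ) [NeZero N]

/-- The exponent `p` is recovered as an integer logarithm, because `k + N ^ p < 2 N ^ p ≤ N ^ (p +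
1)`. These numbers label the target basis vectors of the contractions below. -/
theorem add_pow_injective (hN : 2 ≤ N) :
    Function.Injective (fun i : (p : ℕ) × Fin (N ^ p) => (i.2 : ℕ) + N ^ i.1) := by
  have key : ∀ p (k : Fin (N ^ p)), Nat.log N ((k : ℕ) + N ^ p) = p := by
    intro p k
    refine Nat.log_eq_of_pow_le_of_lt_pow (Nat.le_add_left _ _) ?_
    have := k.2
    calc (k : ℕ) + N ^ p < N ^ p * 2 := by omega
      _ ≤ N ^ p * N := Nat.mul_le_mul_left _ hN
  rintro ⟨p, k⟩ ⟨q, l⟩ h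
  have hpq : p = q := by
    rw [← key p k, ← key q l]
    exact congrArg _ h
  subst hpq
  have : k = l := Fin.ext (Nat.add_right_cancel h)
  rw [this]

/-- There are contractions `l²(ℤ, l²(ℤ⁺)) → l²(ℤ⁺)` which map the basis vector with indices `m`
and `k` to the basis vector with index `k + N ^ (n - m)`, provided that `k < N ^ (n - m)`. -/
theorem exists_tail_contractions (hN : 2 ≤ N) : ∃ K : ℕ → HZ →L[ℂ] H, (∀ n x, ‖K n x‖ ≤ ‖x‖) ∧
    ∀ (n : ℕ) (m : ℤ) (k p : ℕ), m + p = n → k < N ^ p →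
      K n (lp.single 2 m (lp.single 2 k 1)) = lp.single 2 (k + N ^ p) 1 ∧
      ContinuousLinearMap.adjoint (K n) (lp.single 2 (k + N ^ p) 1) =
        lp.single 2 m (lp.single 2 k 1) := by
  have hw := orthonormal_single (add_pow_injective N hN)
  have hinj : ∀ n : ℕ, Function.Injective
      (fun i : (p : ℕ) × Fin (N ^ p) => (((n : ℤ) - i.1, (i.2 : ℕ)) : ℤ × ℕ)) := by
    rintro n ⟨p, k⟩ ⟨q, l⟩ h
    rw [Prod.ext_iff] at h
    obtain ⟨h1, h2⟩ := h
    have hpq : p = q := by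
      have : (n : ℤ) - p = n - q := h1
      omega
    subst hpq
    have : k = l := Fin.ext h2
    rw [this]
  choose K hK using fun n => exists_contraction_of_orthonormal
    (orthonormal_single_single (hinj n)) hw
  refine ⟨K, fun n => (hK n).1, fun n m k p hm hk => ?_⟩
  obtain rfl : m = n - p := by omega
  exact ⟨(hK n).2.1 ⟨p, k, hk⟩, (hK n).2.2 ⟨p, k, hk⟩⟩

/-- The basis vector at `(m, k)` gets exponent `p + 1` although already `k < N ^ p`. The spare unit
leaves room for `S_i^*`, which lowers the exponent by one. -/
theorem exists_tail_exponent (hN : 2 ≤ N) (m : ℤ) (k : ℕ) :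
    ∀ᶠ n : ℕ in atTop, ∃ p : ℕ, m + (p + 1 : ℕ) = n ∧ k < N ^ p := by
  filter_upwards [eventually_ge_atTop (m + k + 1).toNat] with n hn
  refine ⟨(n - m - 1).toNat, by omega, ?_⟩
  calc k < N ^ k := Nat.lt_pow_self hN
    _ ≤ N ^ (n - m - 1).toNat := Nat.pow_le_pow_right (by omega) (by omega)

/-- `(k + N ^ p) N + i = (k N + i) + N ^ (p + 1)`: on labels, `S_i` acts as `S_i` on `k` and raises
`p = n - m` by one, that is, it lowers `m` by one as `V^*` does. So on each basis vector the
intertwining is exact for large `n`. -/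
theorem exists_asympIntertwines_laurentGen (hN : 2 ≤ N) : ∃ K : ℕ → HZ →L[ℂ] H,
    AsympIsometric K ∧ ∀ i, AsympIntertwines K (S N i) (laurentGen N i) := by
  obtain ⟨K, hK, hK'⟩ := exists_tail_contractions N hN
  have hN0 : 0 < N := by omega
  refine ⟨K, AsympIsometric.of_adjoint hK fun x => ?_, fun i => ⟨fun x => ?_, fun x => ?_⟩⟩
  · rw [← tendsto_sub_nhds_zero_iff]
    refine L2.mem_of_single_single_mem (isClosed_nullSubmodule_adjoint hK) (fun m k => ?_) x
    refine tendsto_const_nhds.congr' ?_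
    filter_upwards [exists_tail_exponent N hN m k] with n ⟨p, hp, hk⟩
    have h := hK' n m k (p + 1) hp (hk.trans_le (Nat.pow_le_pow_right hN0 p.le_succ))
    simp [h.1, h.2]
  · refine tendsto_intertwine_of_eventually hK (fun m k => ?_) x
    filter_upwards [exists_tail_exponent N hN m k] with n ⟨p, hp, hk⟩
    have h := hK' n m k (p + 1) hp (hk.trans_le (Nat.pow_le_pow_right hN0 p.le_succ))
    have hk2 : k * N + i < N ^ (p + 2) := by
      calc k * N + i < (k + 1) * N := by rw [add_mul, one_mul]; exact Nat.add_lt_add_left i.2 _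
        _ ≤ N ^ p * N := Nat.mul_le_mul_right _ hk
        _ = N ^ (p + 1) := (pow_succ _ _).symm
        _ ≤ N ^ (p + 2) := Nat.pow_le_pow_right hN0 (by omega)
    have h2 := hK' n (m - 1) (k * N + i) (p + 2) (by push_cast at hp ⊢; omega) hk2
    rw [h.1, laurentGen_single, S_single, S_single, h2.1]
    congr 1
    ring
  · refine tendsto_intertwine_of_eventually hK (fun m k => ?_) x
    filter_upwards [exists_tail_exponent N hN m k] with n ⟨p, hp, hk⟩
    have h := hK' n m k (p + 1) hp (hk.trans_le (Nat.pow_le_pow_right hN0 p.le_succ))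
    rw [h.1, star_laurentGen_single]
    obtain ⟨r, j, rfl⟩ : ∃ (r : ℕ) (j : Fin N), k = r * N + j :=
      ⟨k / N, ⟨k % N, Nat.mod_lt _ hN0⟩, (Nat.div_add_mod' k N).symm⟩
    have hr : r < N ^ p := by
      refine lt_of_le_of_lt ?_ hk
      nlinarith [Nat.zero_le (j : ℕ)]
    have h2 := hK' n (m + 1) r p (by push_cast at hp; omega) hr
    -- Adding a multiple of `N` keeps the last base-`N` digit, so `S_i^*` kills the basis vector
    -- with index `k` exactly when it kills its image.
    have h3 : r * N + (j : ℕ) + N ^ (p + 1) = (r + N ^ p) * N + j := by ring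
    rw [h3]
    by_cases hij : i = j
    · subst hij
      rw [star_S_single_same, star_S_single_same, h2.1]
    · rw [star_S_single_of_ne N hij, star_S_single_of_ne N hij, lp.single_zero, map_zero]

end Compression

/-! ### Evaluation of Laurent operators at a point of the circle -/

section Averaging

/-- The isometry `x ↦ (n + 1)^{-1/2} ∑_{m ≤ n} z^m δ_m ⊗ x`. -/
def avgOp (z : Circle) (n : ℕ) : H →L[ℂ] HZ :=
  ((√(n + 1))⁻¹ : ℂ) • ∑ m ∈ Finset.range (n + 1),
    (z : ℂ) ^ m • lp.singleContinuousLinearMap ℂ (fun _ : ℤ => H) 2 (m : ℤ)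

theorem avgOp_apply (z : Circle) (n : ℕ) (x : H) : avgOp z n x = ((√(n + 1))⁻¹ : ℂ) •
    ∑ m ∈ Finset.range (n + 1), (z : ℂ) ^ m • (lp.single 2 (m : ℤ) x : HZ) := by
  simp [avgOp, sum_apply]

theorem norm_avg_coeff (n : ℕ) : ‖((√(n + 1))⁻¹ : ℂ)‖ = (√(n + 1))⁻¹ := by
  rw [norm_inv, Complex.norm_real, Real.norm_of_nonneg (Real.sqrt_nonneg _)]

theorem norm_avgOp_apply (z : Circle) (n : ℕ) (x : H) : ‖avgOp z n x‖ = ‖x‖ := by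
  have h1 := lp.norm_sum_single (p := 2) (by norm_num) (fun j : ℤ => (z : ℂ) ^ j.toNat • x)
    ((Finset.range (n + 1)).map Nat.castEmbedding)
  rw [Finset.sum_map, Finset.sum_map] at h1
  simp only [Nat.castEmbedding_apply, Int.toNat_natCast, lp.single_smul, norm_smul, norm_pow,
    Circle.norm_coe, one_pow, one_mul, ENNReal.toReal_ofNat, Real.rpow_two, Finset.sum_const,
    Finset.card_range, nsmul_eq_mul] at h1
  rw [avgOp_apply, norm_smul, norm_avg_coeff, ← sq_eq_sq₀ (by positivity) (norm_nonneg _), mul_pow,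
    h1, inv_pow, Real.sq_sqrt (by positivity)]
  push_cast
  field_simp

theorem asympIsometric_avgOp (z : Circle) : AsympIsometric (avgOp z) :=
  ⟨fun n x => (norm_avgOp_apply z n x).le, fun x => by
    simp only [norm_avgOp_apply]
    exact tendsto_const_nhds⟩

theorem diagOp_avgOp (A : H →L[ℂ] H) (z : Circle) (n : ℕ) (x : H) :
    diagOp ℤ A (avgOp z n x) = avgOp z n (A x) := by
  simp only [avgOp_apply, map_smul, map_sum, diagOp_single]

/-- The averages are approximate eigenvectors of `V^*` for `z`: the difference telescopes to two
boundary terms, which the factor `(n + 1)^{-1/2}` makes small. -/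
theorem tendsto_star_V_avgOp (z : Circle) (x : H) :
    Tendsto (fun n => star V (avgOp z n x) - (z : ℂ) • avgOp z n x) atTop (𝓝 0) := by
  have h1 : ∀ n : ℕ, ‖star V (avgOp z n x) - (z : ℂ) • avgOp z n x‖ ≤
      (√((n : ℝ) + 1))⁻¹ * (‖x‖ + ‖x‖) := by
    intro n
    -- `V^*` turns the `m`-th summand into `g m`, and multiplication by `z` turns it into `g (m +
    -- 1)`.
    let g : ℕ → HZ := fun m => (z : ℂ) ^ m • lp.single 2 ((m : ℤ) - 1) x
    have hg : ∀ m, ‖g m‖ = ‖x‖ := fun m => by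
      rw [norm_smul, norm_pow, Circle.norm_coe, one_pow, one_mul, lp.norm_single (by norm_num)]
    have h2 : star V (avgOp z n x) - (z : ℂ) • avgOp z n x =
        ((√(n + 1))⁻¹ : ℂ) • (g 0 - g (n + 1)) := by
      rw [← Finset.sum_range_sub', avgOp_apply, map_smul, map_sum, smul_comm, ← smul_sub,
        Finset.smul_sum, ← Finset.sum_sub_distrib]
      congr 1
      refine Finset.sum_congr rfl fun m _ => ?_
      simp only [g]
      rw [map_smul, star_V_single, smul_smul, ← pow_succ']
      congr 3
      push_cast
      ring
    rw [h2, norm_smul, norm_avg_coeff]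
    gcongr
    exact (norm_sub_le _ _).trans (by rw [hg, hg])
  refine squeeze_zero_norm h1 ?_
  have h3 : Tendsto (fun n : ℕ => √((n : ℝ) + 1)) atTop atTop :=
    Real.tendsto_sqrt_atTop.comp (tendsto_natCast_atTop_atTop.atTop_add tendsto_const_nhds)
  simpa using h3.inv_tendsto_atTop.mul_const (‖x‖ + ‖x‖)

theorem tendsto_V_avgOp (z : Circle) (x : H) :
    Tendsto (fun n => V (avgOp z n x) - conj (z : ℂ) • avgOp z n x) atTop (𝓝 0) := by
  have h1 := ((V.continuous.tendsto 0).comp (tendsto_star_V_avgOp z x)).const_smul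
    (-conj (z : ℂ))
  rw [map_zero, smul_zero] at h1
  refine h1.congr fun n => ?_
  have h2 : V (star V (avgOp z n x)) = avgOp z n x := by
    rw [← mul_apply_eq_comp, V_mul_star_V]
    rfl
  have h3 : conj (z : ℂ) * z = 1 := by
    rw [← Complex.normSq_eq_conj_mul_self, Circle.normSq_coe, Complex.ofReal_one]
  simp only [Function.comp_apply]
  rw [map_sub, map_smul, h2, smul_sub, smul_smul, neg_mul, h3]
  simp only [neg_smul, one_smul]
  abel

variable (N : ℕ) [NeZero N]

theorem asympIntertwines_avgOp (z : Circle) (i : Fin N) :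
    AsympIntertwines (avgOp z) (laurentGen N i) ((z : ℂ) • S N i) := by
  refine ⟨fun x => (tendsto_star_V_avgOp z (S N i x)).congr fun n => ?_,
    fun x => (tendsto_V_avgOp z (star (S N i) x)).congr fun n => ?_⟩
  · rw [laurentGen, ← (commute_star_V_diagOp _).eq, mul_apply_eq_comp, diagOp_avgOp, smul_apply,
      map_smul]
  · rw [star_laurentGen, ← (commute_V_diagOp _).eq, mul_apply_eq_comp, diagOp_avgOp, star_smul,
      smul_apply, map_smul]
    rfl

end Averaging

/-! ### Truncation to the half line and the strong limits -/

section HalfLine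

theorem incl_single (n : ℕ) (x : H) : incl (lp.single 2 n x) = lp.single 2 (n : ℤ) x :=
  relabel_single (⟨Nat.cast, Nat.cast_injective⟩ : ℕ ↪ ℤ) n x

theorem adjoint_incl_apply (y : HZ) (n : ℕ) : ContinuousLinearMap.adjoint incl y n = y (n : ℤ) :=
  adjoint_relabel_apply (⟨Nat.cast, Nat.cast_injective⟩ : ℕ ↪ ℤ) y n

theorem adjoint_incl_incl (x : HH) : ContinuousLinearMap.adjoint incl (incl x) = x :=
  adjoint_linearIsometry_apply _ x

theorem norm_incl (x : HH) : ‖incl x‖ = ‖x‖ := LinearIsometry.norm_map _ x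

theorem norm_adjoint_incl_le (y : HZ) : ‖ContinuousLinearMap.adjoint incl y‖ ≤ ‖y‖ :=
  norm_adjoint_linearIsometry_le _ y

theorem adjoint_incl_single (n : ℕ) (x : H) :
    ContinuousLinearMap.adjoint incl (lp.single 2 (n : ℤ) x) = lp.single 2 n x := by
  rw [← incl_single, adjoint_incl_incl]

theorem V_apply (y : HZ) (m : ℤ) : V y (m + 1) = y m :=
  relabel_apply (⟨fun m : ℤ => m + 1, add_left_injective 1⟩ : ℤ ↪ ℤ) y m

theorem star_V_apply (y : HZ) (m : ℤ) : star V y m = y (m + 1) :=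
  adjoint_relabel_apply (⟨fun m : ℤ => m + 1, add_left_injective 1⟩ : ℤ ↪ ℤ) y m

theorem fshift_apply_zero (x : HH) : fshift x 0 = 0 :=
  relabel_apply_of_notMem succEmb x 0 (by rintro ⟨r, hr⟩; exact Nat.succ_ne_zero r hr)

theorem fshift_apply_succ (x : HH) (n : ℕ) : fshift x (n + 1) = x n :=
  relabel_apply succEmb x n

theorem star_fshift_apply (x : HH) (n : ℕ) : star fshift x n = x (n + 1) :=
  adjoint_relabel_apply succEmb x n

theorem Pi1_apply (x : HH) : Pi1 x = lp.single 2 0 (x 0) := rfl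

theorem fshift_mul_star_fshift : fshift * star fshift = 1 - Pi1 := by
  ext x n : 3
  rw [mul_apply_eq_comp, sub_apply, Pi1_apply, lp.coeFn_sub, Pi.sub_apply]
  cases n with
  | zero => simp [fshift_apply_zero]
  | succ n =>
    rw [fshift_apply_succ, star_fshift_apply, lp.single_apply_ne _ _ _ n.succ_ne_zero, sub_zero]
    rfl

theorem star_fshift_adjoint_incl (y : HZ) :
    star fshift (ContinuousLinearMap.adjoint incl y) =
      ContinuousLinearMap.adjoint incl (star V y) := by
  ext n : 2
  rw [star_fshift_apply, adjoint_incl_apply, adjoint_incl_apply, star_V_apply]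
  push_cast
  rfl

/-- After `V` the entry of `y` at `-1` would enter position `0`, and `1 - Π_1` removes it. The
backward shift needs no such correction, so this is the only source of the ideal `C_N`. -/
theorem fshift_adjoint_incl (y : HZ) :
    fshift (ContinuousLinearMap.adjoint incl y) =
      (1 - Pi1) (ContinuousLinearMap.adjoint incl (V y)) := by
  ext n : 2
  rw [sub_apply, Pi1_apply, lp.coeFn_sub, Pi.sub_apply]
  cases n with
  | zero => simp [fshift_apply_zero]
  | succ n =>
    rw [fshift_apply_succ, lp.single_apply_ne _ _ _ n.succ_ne_zero, sub_zero,
      adjoint_incl_apply, one_apply_eq_self, adjoint_incl_apply]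
    push_cast
    rw [V_apply]

theorem adjoint_incl_diagOp (A : H →L[ℂ] H) (y : HZ) :
    ContinuousLinearMap.adjoint incl (diagOp ℤ A y) =
      diagOp ℕ A (ContinuousLinearMap.adjoint incl y) :=
  adjoint_relabel_diagOp A _ y

/-- The truncations `P V^n : l²(ℤ, l²(ℤ⁺)) → l²(ℤ⁺, l²(ℤ⁺))`. -/
def truncOp (n : ℕ) : HZ →L[ℂ] HH := ContinuousLinearMap.adjoint incl ∘L V ^ n

theorem norm_truncOp_apply_le (n : ℕ) (y : HZ) : ‖truncOp n y‖ ≤ ‖y‖ :=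
  (norm_adjoint_incl_le _).trans (norm_V_pow n y).le

theorem adjoint_truncOp (n : ℕ) :
    ContinuousLinearMap.adjoint (truncOp n) = star (V ^ n) ∘L incl := by
  rw [truncOp, ContinuousLinearMap.adjoint_comp, ContinuousLinearMap.adjoint_adjoint]
  rfl

theorem tendsto_adjoint_truncOp_truncOp (y : HZ) :
    Tendsto (fun n => ContinuousLinearMap.adjoint (truncOp n) (truncOp n y)) atTop (𝓝 y) := by
  rw [← tendsto_sub_nhds_zero_iff]
  refine L2.mem_of_single_mem (isClosed_nullSubmodule_adjoint norm_truncOp_apply_le)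
    (fun m x => ?_) y
  refine tendsto_const_nhds.congr' ?_
  filter_upwards [eventually_ge_atTop (-m).toNat] with n hn
  obtain ⟨p, hp⟩ : ∃ p : ℕ, m + n = p := ⟨(m + n).toNat, by omega⟩
  have h1 : truncOp n (lp.single 2 m x) = lp.single 2 p x := by
    rw [truncOp, ContinuousLinearMap.comp_apply, V_pow_single, hp, adjoint_incl_single]
  have h2 : ContinuousLinearMap.adjoint (truncOp n) (lp.single 2 p x) = lp.single 2 m x := by
    rw [adjoint_truncOp, ContinuousLinearMap.comp_apply, incl_single, star_V_pow_single, ← hp,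
      add_sub_cancel_right]
  rw [sub_apply, ContinuousLinearMap.comp_apply, h1, h2]
  simp

theorem asympIsometric_truncOp : AsympIsometric truncOp :=
  AsympIsometric.of_adjoint norm_truncOp_apply_le tendsto_adjoint_truncOp_truncOp

theorem shifted_apply (B : HH →L[ℂ] HH) (n : ℕ) (y : HZ) :
    shifted B n y = ContinuousLinearMap.adjoint (truncOp n) (B (truncOp n y)) := by
  rw [adjoint_truncOp]
  rfl

/-- With `J_n` the truncations, `V_n^* B V_n = J_n^* B J_n`, which is `J_n^* J_n W` up to a strongly
null term, and `J_n^* J_n → 1` strongly. -/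
theorem AsympIntertwines.tendsto_shifted {B : HH →L[ℂ] HH} {W : HZ →L[ℂ] HZ}
    (h : AsympIntertwines truncOp B W) (y : HZ) :
    Tendsto (fun n => shifted B n y) atTop (𝓝 (W y)) := by
  have h1 : Tendsto (fun n => ContinuousLinearMap.adjoint (truncOp n)
      (B (truncOp n y) - truncOp n (W y))) atTop (𝓝 0) :=
    squeeze_zero_norm (fun n => norm_adjoint_apply_le (norm_truncOp_apply_le n) _)
      (tendsto_zero_iff_norm_tendsto_zero.1 (h.tendsto y))
  have h2 := h1.add (tendsto_adjoint_truncOp_truncOp (W y))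
  rw [zero_add] at h2
  refine h2.congr fun n => ?_
  rw [shifted_apply, map_sub, sub_add_cancel]

theorem tendsto_Pi1_truncOp (y : HZ) : Tendsto (fun n => Pi1 (truncOp n y)) atTop (𝓝 0) := by
  have h1 : ∀ n x, ‖(Pi1 ∘L truncOp n) x‖ ≤ ‖Pi1‖ * ‖x‖ := fun n x =>
    (Pi1.le_opNorm _).trans (by gcongr; exact norm_truncOp_apply_le n x)
  refine L2.mem_of_single_mem (isClosed_nullSubmodule h1) (fun m x => ?_) y
  refine tendsto_const_nhds.congr' ?_
  -- From here on `m + n ≥ 1`, so the shifted basis vector has left position `0`.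
  filter_upwards [eventually_ge_atTop (1 - m).toNat] with n hn
  obtain ⟨p, hp⟩ : ∃ p : ℕ, m + n = (p + 1 : ℕ) := ⟨(m + n - 1).toNat, by omega⟩
  rw [ContinuousLinearMap.comp_apply, truncOp, ContinuousLinearMap.comp_apply, V_pow_single, hp,
    adjoint_incl_single, Pi1_apply, lp.single_apply_ne _ _ _ (by omega), lp.single_zero]

variable (N : ℕ) [NeZero N]

theorem Sig_adjoint_incl (i : Fin N) (y : HZ) :
    Sig N i (ContinuousLinearMap.adjoint incl y) =
      ContinuousLinearMap.adjoint incl (laurentGen N i y) := by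
  rw [laurentGen, mul_apply_eq_comp, adjoint_incl_diagOp, ← star_fshift_adjoint_incl]
  rfl

theorem star_Sig (i : Fin N) : star (Sig N i) = fshift * diagOp ℕ (star (S N i)) := by
  rw [Sig, star_mul, star_star]
  exact congrArg _ (star_diagOp (ι := ℕ) (S N i))

theorem star_Sig_adjoint_incl (i : Fin N) (y : HZ) :
    star (Sig N i) (ContinuousLinearMap.adjoint incl y) =
      (1 - Pi1) (ContinuousLinearMap.adjoint incl (star (laurentGen N i) y)) := by
  rw [star_Sig, mul_apply_eq_comp, ← adjoint_incl_diagOp, fshift_adjoint_incl, star_laurentGen,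
    ← mul_apply_eq_comp V, (commute_V_diagOp _).eq]

theorem commute_V_laurentGen (i : Fin N) : Commute V (laurentGen N i) := by
  refine (commute_V_diagOp _).mul_right ?_
  change V * star V = star V * V
  rw [V_mul_star_V, star_V_mul_V]

theorem commute_V_star_laurentGen (i : Fin N) : Commute V (star (laurentGen N i)) := by
  rw [star_laurentGen]
  exact (commute_V_diagOp _).mul_right (Commute.refl V)

theorem asympIntertwines_truncOp (i : Fin N) :
    AsympIntertwines truncOp (Sig N i) (laurentGen N i) := by
  refine ⟨fun y => ?_, fun y => ?_⟩
  · refine tendsto_const_nhds.congr fun n => ?_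
    rw [truncOp, ContinuousLinearMap.comp_apply, Sig_adjoint_incl, ContinuousLinearMap.comp_apply,
      ← mul_apply_eq_comp, ← mul_apply_eq_comp, ((commute_V_laurentGen N i).pow_left n).eq,
      sub_self]
  · have h := (tendsto_Pi1_truncOp (star (laurentGen N i) y)).neg
    rw [neg_zero] at h
    refine h.congr fun n => ?_
    rw [truncOp, ContinuousLinearMap.comp_apply, ContinuousLinearMap.comp_apply,
      star_Sig_adjoint_incl, ← mul_apply_eq_comp (star (laurentGen N i)),
      ← mul_apply_eq_comp (V ^ n), ((commute_V_star_laurentGen N i).pow_left n).eq,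
      sub_apply, one_apply_eq_self]
    abel

end HalfLine

/-! ### The Laurent representation of `O_N` and its faithfulness -/

section Representations

variable (N : ℕ) [NeZero N]

theorem isClosed_cuntzAlg : IsClosed (cuntzAlg N : Set (H →L[ℂ] H)) :=
  StarSubalgebra.isClosed_topologicalClosure _

instance : CompleteSpace (cuntzAlg N) := (isClosed_cuntzAlg N).completeSpace_coe

theorem cuntzAlg_hom_ext {B : Type*} [NormedRing B] [NormedAlgebra ℂ B] [StarRing B]
    [StarModule ℂ B] [ContinuousStar B] {f g : cuntzAlg N →⋆ₐ[ℂ] B} (hf : Continuous f)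
    (hg : Continuous g) (h : ∀ i, f (gen N i) = g (gen N i)) : f = g := by
  refine starAlgHom_ext_of_generators (G := Set.range (S N)) hf hg ?_
  rintro _ ⟨i, rfl⟩
  exact h i

theorem cuntzAlg_hom_mem {B : Type*} [NormedRing B] [NormedAlgebra ℂ B] [StarRing B]
    [StarModule ℂ B] [ContinuousStar B] {f : cuntzAlg N →⋆ₐ[ℂ] B} (hf : Continuous f)
    {U : StarSubalgebra ℂ B} (hU : IsClosed (U : Set B)) (h : ∀ i, f (gen N i) ∈ U)
    (A : cuntzAlg N) : f A ∈ U := by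
  refine starAlgHom_mem_of_generators (G := Set.range (S N)) f hf hU ?_ A
  rintro _ ⟨i, rfl⟩
  exact h i

theorem exists_laurentRep (hN : 2 ≤ N) : ∃ π : cuntzAlg N →⋆ₐ[ℂ] (HZ →L[ℂ] HZ),
    (∀ A, ‖π A‖ ≤ ‖A‖) ∧ ∀ i, π (gen N i) = laurentGen N i := by
  obtain ⟨K, hK, hK'⟩ := exists_asympIntertwines_laurentGen N hN
  obtain ⟨π, hπ⟩ := exists_starAlgHom_asympIntertwines hK (G := Set.range (S N)) (by
    rintro _ ⟨i, rfl⟩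
    exact ⟨_, hK' i⟩)
  exact ⟨π, fun A => (hπ A).norm_le hK, fun i => (hπ (gen N i)).unique hK (hK' i)⟩

/-- The `C*`-algebra generated by the Laurent generators. -/
def laurentAlg : StarSubalgebra ℂ (HZ →L[ℂ] HZ) :=
  (StarAlgebra.adjoin ℂ (Set.range (laurentGen N))).topologicalClosure

theorem isClosed_laurentAlg : IsClosed (laurentAlg N : Set (HZ →L[ℂ] HZ)) :=
  StarSubalgebra.isClosed_topologicalClosure _

theorem laurentGen_mem (i : Fin N) : laurentGen N i ∈ laurentAlg N :=
  StarSubalgebra.le_topologicalClosure _ (StarAlgebra.subset_adjoin ℂ _ ⟨i, rfl⟩)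

theorem exists_evaluation (z : Circle) : ∃ Θ : laurentAlg N →⋆ₐ[ℂ] (H →L[ℂ] H),
    (∀ A, ‖Θ A‖ ≤ ‖A‖) ∧ ∀ i, Θ ⟨laurentGen N i, laurentGen_mem N i⟩ = (z : ℂ) • S N i := by
  have hK := asympIsometric_avgOp z
  have hK' := asympIntertwines_avgOp N z
  obtain ⟨Θ, hΘ⟩ := exists_starAlgHom_asympIntertwines hK (G := Set.range (laurentGen N)) (by
    rintro _ ⟨i, rfl⟩
    exact ⟨_, hK' i⟩)
  exact ⟨Θ, fun A => (hΘ A).norm_le hK,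
    fun i => (hΘ ⟨laurentGen N i, laurentGen_mem N i⟩).unique hK (hK' i)⟩

variable {N} (hN : 2 ≤ N)

/-- The representation of `O_N` on `l²(ℤ, l²(ℤ⁺))` by Laurent operators. -/
def laurentRep : cuntzAlg N →⋆ₐ[ℂ] (HZ →L[ℂ] HZ) := (exists_laurentRep N hN).choose

theorem norm_laurentRep_le (A : cuntzAlg N) : ‖laurentRep hN A‖ ≤ ‖A‖ :=
  (exists_laurentRep N hN).choose_spec.1 A

theorem laurentRep_gen (i : Fin N) : laurentRep hN (gen N i) = laurentGen N i :=
  (exists_laurentRep N hN).choose_spec.2 i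

theorem continuous_laurentRep : Continuous (laurentRep hN) :=
  AddMonoidHomClass.continuous_of_bound (laurentRep hN) 1 fun A => by
    rw [one_mul]
    exact norm_laurentRep_le hN A

theorem laurentRep_mem (A : cuntzAlg N) : laurentRep hN A ∈ laurentAlg N :=
  cuntzAlg_hom_mem N (continuous_laurentRep hN) (isClosed_laurentAlg N)
    (fun i => by rw [laurentRep_gen]; exact laurentGen_mem N i) A

/-- `ρ` is evaluation at `z` after `laurentRep`. The bound is by `‖laurentRep hN A‖` rather than
`‖A‖` because at `z = 1`, where `ρ` is the identity, it shows that `laurentRep` is isometric. -/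
theorem exists_gaugeHom (z : Circle) : ∃ ρ : cuntzAlg N →⋆ₐ[ℂ] cuntzAlg N,
    (∀ A, ‖ρ A‖ ≤ ‖laurentRep hN A‖) ∧ ∀ i, ρ (gen N i) = (z : ℂ) • gen N i := by
  obtain ⟨Θ, hΘ, hΘ'⟩ := exists_evaluation N z
  let π := (laurentRep hN).codRestrict (laurentAlg N) (laurentRep_mem hN)
  have hgen : ∀ i, Θ.comp π (gen N i) = (z : ℂ) • S N i := fun i => by
    rw [← hΘ' i, StarAlgHom.comp_apply]
    exact congrArg Θ (Subtype.ext (laurentRep_gen hN i))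
  have hle : ∀ A, ‖Θ.comp π A‖ ≤ ‖laurentRep hN A‖ := fun A => hΘ (π A)
  have hcont : Continuous (Θ.comp π) := AddMonoidHomClass.continuous_of_bound (Θ.comp π) 1
    fun A => by
      rw [one_mul]
      exact (hle A).trans (norm_laurentRep_le hN A)
  have hmem : ∀ A, Θ.comp π A ∈ cuntzAlg N := cuntzAlg_hom_mem N hcont (isClosed_cuntzAlg N)
    fun i => by
      rw [hgen]
      exact (cuntzAlg N).smul_mem (gen N i).2 _
  refine ⟨(Θ.comp π).codRestrict (cuntzAlg N) hmem, hle, fun i => Subtype.ext (hgen i)⟩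

theorem continuous_of_norm_le_laurentRep {ρ : cuntzAlg N →⋆ₐ[ℂ] cuntzAlg N}
    (hρ : ∀ A, ‖ρ A‖ ≤ ‖laurentRep hN A‖) : Continuous ρ :=
  AddMonoidHomClass.continuous_of_bound ρ 1 fun A => by
    rw [one_mul]
    exact (hρ A).trans (norm_laurentRep_le hN A)

theorem norm_laurentRep (A : cuntzAlg N) : ‖laurentRep hN A‖ = ‖A‖ := by
  refine le_antisymm (norm_laurentRep_le hN A) ?_
  obtain ⟨ρ, hρ, hρ'⟩ := exists_gaugeHom hN 1
  have h : ρ = StarAlgHom.id ℂ _ :=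
    cuntzAlg_hom_ext N (continuous_of_norm_le_laurentRep hN hρ) continuous_id fun i => by
      rw [hρ' i, Circle.coe_one, one_smul]
      rfl
  have := hρ A
  rwa [h] at this

theorem exists_isGauge {N : ℕ} [NeZero N] (hN : 2 ≤ N) (z : Circle) : ∃ ρ, IsGauge N z ρ := by
  -- The gauge convention multiplies by `conj z = z⁻¹`; the homomorphism for `z` is the inverse.
  obtain ⟨ρ, hρ, hρ'⟩ := exists_gaugeHom hN z⁻¹
  obtain ⟨σ, hσ, hσ'⟩ := exists_gaugeHom hN z
  have hρc := continuous_of_norm_le_laurentRep hN hρ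
  have hσc := continuous_of_norm_le_laurentRep hN hσ
  refine ⟨StarAlgEquiv.ofStarAlgHom ρ σ
    (cuntzAlg_hom_ext N (hσc.comp hρc) continuous_id fun i => ?_)
    (cuntzAlg_hom_ext N (hρc.comp hσc) continuous_id fun i => ?_), fun i => ?_⟩
  · calc σ (ρ (gen N i)) = ((z⁻¹ : Circle) : ℂ) • σ (gen N i) := by rw [hρ' i]; exact map_smul σ _ _
      _ = gen N i := by
        rw [hσ' i, smul_smul, ← Circle.coe_mul, inv_mul_cancel, Circle.coe_one, one_smul]
  · calc ρ (σ (gen N i)) = (z : ℂ) • ρ (gen N i) := by rw [hσ' i]; exact map_smul ρ _ _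
      _ = gen N i := by
        rw [hρ' i, smul_smul, ← Circle.coe_mul, mul_inv_cancel, Circle.coe_one, one_smul]
  · rw [← Circle.coe_inv_eq_conj]
    exact hρ' i

end Representations

/-! ### Uniqueness of the gauge automorphisms -/

section Gauge

variable (N : ℕ) [NeZero N]

/-- `*`-automorphisms of a `C*`-algebra are automatically isometric, so uniqueness of `ρ_z` requires
no continuity assumption. -/
theorem norm_starAlgEquiv_cuntzAlg (ρ : cuntzAlg N ≃⋆ₐ[ℂ] cuntzAlg N) (A : cuntzAlg N) :
    ‖ρ A‖ = ‖A‖ := by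
  have := isClosed_cuntzAlg N
  let _ : CStarAlgebra (cuntzAlg N) := StarSubalgebra.cstarAlgebra (cuntzAlg N)
  exact StarAlgEquiv.norm_map ρ A

theorem IsGauge.unique {z : Circle} {ρ σ : cuntzAlg N ≃⋆ₐ[ℂ] cuntzAlg N} (hρ : IsGauge N z ρ)
    (hσ : IsGauge N z σ) : ρ = σ := by
  have hc : ∀ τ : cuntzAlg N ≃⋆ₐ[ℂ] cuntzAlg N, Continuous τ := fun τ =>
    AddMonoidHomClass.continuous_of_bound τ 1 fun A => by
      rw [one_mul, norm_starAlgEquiv_cuntzAlg]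
  have h := cuntzAlg_hom_ext N (f := (ρ : cuntzAlg N →⋆ₐ[ℂ] cuntzAlg N))
    (g := (σ : cuntzAlg N →⋆ₐ[ℂ] cuntzAlg N)) (hc ρ) (hc σ)
    fun i => (hρ i).trans (hσ i).symm
  ext A : 1
  exact congrArg (fun f : cuntzAlg N →⋆ₐ[ℂ] cuntzAlg N => f A) h

theorem isGauge_gauge (hN : 2 ≤ N) (z : Circle) : IsGauge N z (gauge N z) := by
  have h := exists_isGauge hN z
  rw [gauge, dif_pos h]
  exact h.choose_spec

end Gauge

/-! ### The dense span of the elements `S_l S_m^*` -/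

section Words

variable (N : ℕ) [NeZero N]

/-- The word `S_l` as an element of `O_N`. -/
def genWord (l : List (Fin N)) : cuntzAlg N := (l.map (gen N)).prod

variable {N}

theorem genWord_cons (i : Fin N) (l : List (Fin N)) :
    genWord N (i :: l) = gen N i * genWord N l := by
  simp [genWord]

theorem genWord_nil : genWord N [] = 1 := rfl

theorem coe_genWord (l : List (Fin N)) : (genWord N l : H →L[ℂ] H) = word N l := by
  induction l with
  | nil => rfl
  | cons i l ih =>
    rw [genWord_cons, MulMemClass.coe_mul, ih]
    simp [word, gen]

/-- The element `S_l S_m^*` of `O_N`. -/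
def wordPair (l m : List (Fin N)) : cuntzAlg N := genWord N l * star (genWord N m)

theorem coe_wordPair (l m : List (Fin N)) :
    (wordPair l m : H →L[ℂ] H) = word N l * star (word N m) := by
  rw [wordPair, MulMemClass.coe_mul, coe_genWord, ← coe_genWord m]
  rfl

theorem word_cons (i : Fin N) (l : List (Fin N)) : word N (i :: l) = S N i * word N l := by
  simp [word]

theorem word_append (l m : List (Fin N)) : word N (l ++ m) = word N l * word N m := by
  simp [word]

/-- Left multiplication by `S_i^*` cancels the first letter of `l` or gives `0`; if `l` is empty,
the letter joins the end of `m`. -/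
theorem adjoin_S_le_span : ∀ A ∈ StarAlgebra.adjoin ℂ (Set.range (S N)),
    A ∈ Submodule.span ℂ {A | ∃ l m : List (Fin N), A = word N l * star (word N m)} := by
  intro A hA
  refine adjoin_le_of_mul_mem (Submodule.span ℂ _) (Submodule.subset_span ?_) ?_ hA
  · exact ⟨[], [], by simp [word]⟩
  rintro _ ⟨i, rfl⟩ x hx
  induction hx using Submodule.span_induction with
  | mem x hx =>
    obtain ⟨l, m, rfl⟩ := hx
    refine ⟨Submodule.subset_span ⟨i :: l, m, by rw [word_cons, mul_assoc]⟩, ?_⟩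
    cases l with
    | nil =>
      refine Submodule.subset_span ⟨[], m ++ [i], ?_⟩
      rw [word_append, star_mul]
      simp [word]
    | cons j l =>
      rw [word_cons, ← mul_assoc, ← mul_assoc, star_S_mul_S]
      split_ifs
      · rw [one_mul]
        exact Submodule.subset_span ⟨l, m, rfl⟩
      · rw [zero_mul, zero_mul]
        exact Submodule.zero_mem _
  | zero => simp
  | add x y _ _ hx hy =>
    rw [mul_add, mul_add]
    exact ⟨Submodule.add_mem _ hx.1 hy.1, Submodule.add_mem _ hx.2 hy.2⟩
  | smul c x _ hx =>
    rw [mul_smul_comm, mul_smul_comm]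
    exact ⟨Submodule.smul_mem _ _ hx.1, Submodule.smul_mem _ _ hx.2⟩

theorem mem_of_wordPair_mem {Q : Submodule ℂ (cuntzAlg N)}
    (hQ : IsClosed (Q : Set (cuntzAlg N))) (h : ∀ l m, wordPair l m ∈ Q) (A : cuntzAlg N) :
    A ∈ Q := by
  obtain ⟨A, hA⟩ := A
  obtain ⟨u, hu, hlim⟩ := mem_closure_iff_seq_limit.1 hA
  have hu' : ∀ n, u n ∈ Q.map (cuntzAlg N).subtype.toAlgHom.toLinearMap := fun n => by
    refine Submodule.span_le.2 ?_ (adjoin_S_le_span _ (hu n))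
    rintro _ ⟨l, m, rfl⟩
    exact ⟨wordPair l m, h l m, coe_wordPair l m⟩
  choose v hv hvu using hu'
  refine hQ.mem_of_tendsto (f := v) (b := atTop) ?_ (Eventually.of_forall hv)
  rw [tendsto_subtype_rng]
  exact hlim.congr fun n => (hvu n).symm

theorem clm_ext_of_wordPair {E : Type*} [NormedAddCommGroup E] [NormedSpace ℂ E]
    {f g : cuntzAlg N →L[ℂ] E} (h : ∀ l m, f (wordPair l m) = g (wordPair l m)) : f = g := by
  ext A
  exact mem_of_wordPair_mem (Q := LinearMap.eqLocus f.toLinearMap g.toLinearMap)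
    (isClosed_eq f.continuous g.continuous) h A

theorem gauge_genWord (hN : 2 ≤ N) (z : Circle) (l : List (Fin N)) :
    gauge N z (genWord N l) = conj (z : ℂ) ^ l.length • genWord N l := by
  induction l with
  | nil => simp [genWord_nil]
  | cons i l ih =>
    rw [genWord_cons, map_mul, ih, isGauge_gauge N hN z i, smul_mul_smul_comm, List.length_cons,
      pow_succ']

theorem gauge_wordPair (hN : 2 ≤ N) (z : Circle) (l m : List (Fin N)) :
    gauge N z (wordPair l m) =
      ((z ^ ((m.length : ℤ) - l.length) : Circle) : ℂ) • wordPair l m := by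
  rw [wordPair, map_mul, map_star, gauge_genWord hN, gauge_genWord hN, star_smul,
    smul_mul_smul_comm, zpow_sub, ← Circle.coe_inv_eq_conj, star_pow, Complex.star_def,
    ← Circle.coe_inv_eq_conj, inv_inv, mul_comm, zpow_natCast, zpow_natCast, ← inv_pow]
  simp

theorem laurentRep_genWord_single (hN : 2 ≤ N) (l : List (Fin N)) (k : ℤ) (x : H) :
    laurentRep hN (genWord N l) (lp.single 2 k x) =
      lp.single 2 (k - l.length) (word N l x) := by
  induction l with
  | nil => simp [genWord_nil, word]
  | cons i l ih =>
    rw [genWord_cons, map_mul, mul_apply_eq_comp, ih, laurentRep_gen, laurentGen_single,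
      word_cons, mul_apply_eq_comp, List.length_cons]
    push_cast
    rw [sub_sub]

theorem laurentRep_star_genWord_single (hN : 2 ≤ N) (l : List (Fin N)) (k : ℤ) (x : H) :
    laurentRep hN (star (genWord N l)) (lp.single 2 k x) =
      lp.single 2 (k + l.length) (star (word N l) x) := by
  induction l generalizing k x with
  | nil => simp [genWord_nil, word]
  | cons i l ih =>
    rw [genWord_cons, star_mul, map_mul, mul_apply_eq_comp, map_star _ (gen N i), laurentRep_gen,
      star_laurentGen_single, ih, word_cons, star_mul, mul_apply_eq_comp, List.length_cons]
    push_cast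
    rw [add_assoc, add_comm 1]

theorem laurentRep_wordPair_single (hN : 2 ≤ N) (l m : List (Fin N)) (k : ℤ) (x : H) :
    laurentRep hN (wordPair l m) (lp.single 2 k x) =
      lp.single 2 (k + (m.length - l.length)) ((wordPair l m : H →L[ℂ] H) x) := by
  rw [wordPair, map_mul, mul_apply_eq_comp, laurentRep_star_genWord_single,
    laurentRep_genWord_single, ← wordPair, coe_wordPair, mul_apply_eq_comp, add_sub_assoc]

end Words

/-! ### Fourier coefficients of `f_A` as blocks of the Laurent operator -/

section Coefficients

variable {N : ℕ} [NeZero N]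

/-- The representation by Laurent operators as a continuous linear map. -/
def laurentRepL (hN : 2 ≤ N) : cuntzAlg N →L[ℂ] (HZ →L[ℂ] HZ) :=
  ⟨(laurentRep hN).toAlgHom.toLinearMap, continuous_laurentRep hN⟩

/-- The `(m, k)`-th block of the Laurent operator of an element of `O_N`. -/
def laurentEntry (hN : 2 ≤ N) (m k : ℤ) : cuntzAlg N →L[ℂ] (H →L[ℂ] H) :=
  (ContinuousLinearMap.compL ℂ H HZ H (lp.evalCLM ℂ (fun _ : ℤ => H) 2 m)) ∘L
    ((ContinuousLinearMap.compL ℂ H HZ HZ).flip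
      (lp.singleContinuousLinearMap ℂ (fun _ : ℤ => H) 2 k)) ∘L laurentRepL hN

theorem laurentEntry_apply (hN : 2 ≤ N) (m k : ℤ) (A : cuntzAlg N) (x : H) :
    laurentEntry hN m k A x = laurentRep hN A (lp.single 2 k x) m := rfl

theorem laurentEntry_wordPair (hN : 2 ≤ N) (m k : ℤ) (l l' : List (Fin N)) :
    laurentEntry hN m k (wordPair l l') =
      if m = k + (l'.length - l.length) then (wordPair l l' : H →L[ℂ] H) else 0 := by
  ext1 x
  rw [laurentEntry_apply, laurentRep_wordPair_single, lp.single_apply]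
  split_ifs with h
  · rw [h, Pi.single_eq_same]
  · rw [Pi.single_eq_of_ne h, zero_apply]

theorem laurentEntry_eq_sub_zero (hN : 2 ≤ N) (m k : ℤ) :
    laurentEntry hN m k = laurentEntry hN (m - k) 0 := by
  refine clm_ext_of_wordPair fun l l' => ?_
  rw [laurentEntry_wordPair, laurentEntry_wordPair]
  refine if_congr ?_ rfl rfl
  constructor <;> intro h <;> linarith

variable (N) in
theorem symb_eq (A : cuntzAlg N) (z : Circle) : symb N A z = gauge N z A := rfl

theorem norm_symb_le (A : cuntzAlg N) (z : Circle) : ‖symb N A z‖ ≤ ‖A‖ :=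
  (norm_starAlgEquiv_cuntzAlg N (gauge N z) A).le

theorem symb_add (A B : cuntzAlg N) (z : Circle) :
    symb N (A + B) z = symb N A z + symb N B z := by
  rw [symb_eq, map_add]
  rfl

theorem symb_smul (c : ℂ) (A : cuntzAlg N) (z : Circle) :
    symb N (c • A) z = c • symb N A z := by
  rw [symb_eq, map_smul]
  rfl

theorem symb_sub (A B : cuntzAlg N) (z : Circle) :
    symb N (A - B) z = symb N A z - symb N B z := by
  rw [symb_eq, map_sub]
  rfl

theorem symb_wordPair (hN : 2 ≤ N) (l m : List (Fin N)) (z : Circle) :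
    symb N (wordPair l m) z =
      ((z ^ ((m.length : ℤ) - l.length) : Circle) : ℂ) • (wordPair l m : H →L[ℂ] H) := by
  rw [symb_eq, gauge_wordPair hN]
  rfl

/-- `f_A` depends on `A` contractively in the uniform norm, so continuity passes to limits from the
elements `S_l S_m^*`, where `f_A` is a monomial. -/
theorem continuous_symb (hN : 2 ≤ N) (A : cuntzAlg N) : Continuous (symb N A) := by
  let Q : Submodule ℂ (cuntzAlg N) :=
    { carrier := {A | Continuous (symb N A)}
      add_mem' := fun {A B} hA hB => (hA.add hB).congr fun z => (symb_add A B z).symm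
      zero_mem' := by
        have h : symb N (0 : cuntzAlg N) = fun _ => 0 := funext fun z => by
          rw [symb_eq, map_zero]
          rfl
        change Continuous (symb N 0)
        rw [h]
        exact continuous_const
      smul_mem' := fun c A hA => (hA.const_smul c).congr fun z => (symb_smul c A z).symm }
  refine mem_of_wordPair_mem (Q := Q) (isClosed_of_closure_subset fun B hB => ?_)
    (fun l m => ?_) A
  · refine continuous_of_uniform_approx_of_continuous fun u hu => ?_
    obtain ⟨ε, hε, hεu⟩ := Metric.mem_uniformity_dist.1 hu
    obtain ⟨C, hC, hBC⟩ := Metric.mem_closure_iff.1 hB ε hε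
    refine ⟨symb N C, hC, fun z => hεu ?_⟩
    rw [dist_eq_norm, ← symb_sub]
    rw [dist_eq_norm] at hBC
    exact (norm_symb_le _ z).trans_lt hBC
  · have : symb N (wordPair l m) = fun z : Circle =>
        ((z ^ ((m.length : ℤ) - l.length) : Circle) : ℂ) • (wordPair l m : H →L[ℂ] H) :=
      funext (symb_wordPair hN l m)
    change Continuous (symb N (wordPair l m))
    rw [this]
    have hc : Continuous (fun z : Circle => (z : ℂ)) := by fun_prop
    exact (hc.comp (continuous_zpow _)).smul continuous_const

theorem integrable_symb (hN : 2 ≤ N) (A : cuntzAlg N) :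
    MeasureTheory.Integrable (fun t : AddCircle (1 : ℝ) => symb N A (AddCircle.toCircle t))
      AddCircle.haarAddCircle :=
  ((continuous_symb hN A).comp AddCircle.continuous_toCircle).integrable_of_hasCompactSupport
    (HasCompactSupport.of_compactSpace _)

/-- The Fourier coefficients of `f_A` depend linearly and continuously on `A`. -/
def symbCoeff (hN : 2 ≤ N) (k : ℤ) : cuntzAlg N →L[ℂ] (H →L[ℂ] H) :=
  LinearMap.mkContinuous
    { toFun := fun A => coeff (symb N A) k
      map_add' := fun A B => by
        have h := congrFun (fourierCoeff.add (integrable_symb hN A) (integrable_symb hN B)) k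
        refine Eq.trans ?_ h
        exact congrArg (fun f => fourierCoeff f k) (funext fun t => symb_add A B _)
      map_smul' := fun c A => by
        refine Eq.trans ?_ (fourierCoeff.const_smul
          (fun t : AddCircle (1 : ℝ) => symb N A (AddCircle.toCircle t)) c k)
        exact congrArg (fun f => fourierCoeff f k) (funext fun t => symb_smul c A _) } 1
    fun A => by
      change ‖∫ t, _ ∂_‖ ≤ _
      refine (MeasureTheory.norm_integral_le_of_norm_le_const (C := 1 * ‖A‖)
        (Eventually.of_forall fun t => ?_)).trans (by simp)
      rw [norm_smul, fourier_apply, Circle.norm_coe]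
      gcongr
      exact norm_symb_le A _

theorem coeff_symb_wordPair (hN : 2 ≤ N) (l m : List (Fin N)) (k : ℤ) :
    coeff (symb N (wordPair l m)) k =
      if k = m.length - l.length then (wordPair l m : H →L[ℂ] H) else 0 := by
  have h : (fun t : AddCircle (1 : ℝ) => symb N (wordPair l m) (AddCircle.toCircle t)) =
      fun t => fourier ((m.length : ℤ) - l.length) t • (wordPair l m : H →L[ℂ] H) := by
    funext t
    rw [symb_wordPair hN, fourier_apply, AddCircle.toCircle_zsmul]
  rw [coeff, h, fourierCoeff]
  simp only [smul_smul]
  rw [integral_smul_const]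
  have h2 := congrFun (fourierCoeff_fourier (T := 1) ((m.length : ℤ) - l.length)) k
  rw [fourierCoeff] at h2
  simp only [smul_eq_mul] at h2
  rw [h2, Pi.single_apply]
  split_ifs <;> simp

/-- Both sides are continuous and linear in `A`, and on `S_l S_m^*` both pick out the same degree
`|m| - |l|`. -/
theorem coeff_symb (hN : 2 ≤ N) (A : cuntzAlg N) (m k : ℤ) :
    coeff (symb N A) (m - k) = laurentEntry hN m k A := by
  have h : symbCoeff hN (m - k) = laurentEntry hN m k := by
    rw [laurentEntry_eq_sub_zero]
    refine clm_ext_of_wordPair fun l l' => ?_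
    rw [laurentEntry_wordPair, zero_add]
    exact coeff_symb_wordPair hN l l' (m - k)
  exact congrArg (fun f : cuntzAlg N →L[ℂ] (H →L[ℂ] H) => f A) h

end Coefficients

/-! ### The expectation `Φ₀` and the identity `T(f_A) = Ψ(A)` -/

section Expectation

variable {N : ℕ} [NeZero N]

theorem parAlg_le_cuntzAlg : parAlg N ≤ cuntzAlg N := by
  refine StarSubalgebra.topologicalClosure_minimal (StarAlgebra.adjoin_le ?_) (isClosed_cuntzAlg N)
  rintro _ ⟨l, m, -, rfl⟩
  rw [← coe_wordPair]
  exact (wordPair l m).2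

theorem word_mul_star_word_mem_parAlg {l m : List (Fin N)} (h : l.length = m.length) :
    word N l * star (word N m) ∈ parAlg N :=
  StarSubalgebra.le_topologicalClosure _ (StarAlgebra.subset_adjoin ℂ _ ⟨l, m, h, rfl⟩)

theorem laurentRep_of_mem_parAlg (hN : 2 ≤ N) {A : cuntzAlg N}
    (hA : (A : H →L[ℂ] H) ∈ parAlg N) : laurentRep hN A = diagOp ℤ (A : H →L[ℂ] H) := by
  refine starAlgHom_eq_of_generators
    (G := {A | ∃ l m : List (Fin N), l.length = m.length ∧ A = word N l * star (word N m)})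
    (V := cuntzAlg N) (g := diagHom (E := H) ℤ) (continuous_laurentRep hN) continuous_diagHom
    ?_ A hA
  rintro _ ⟨l, m, hlm, rfl⟩
  refine ⟨wordPair l m, coe_wordPair l m, L2.clm_ext fun k x => ?_⟩
  rw [laurentRep_wordPair_single, hlm, sub_self, add_zero, coe_wordPair]
  exact (diagOp_single _ _ _).symm

theorem laurentRep_gen_pow_single (hN : 2 ≤ N) (n : ℕ) (k : ℤ) (x : H) :
    laurentRep hN (gen N 0 ^ n) (lp.single 2 k x) = lp.single 2 (k - n) ((S N 0 ^ n) x) := by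
  have h := laurentRep_genWord_single hN (List.replicate n (0 : Fin N)) k x
  simpa [genWord, word] using h

theorem laurentRep_star_gen_pow_single (hN : 2 ≤ N) (n : ℕ) (k : ℤ) (x : H) :
    laurentRep hN (star (gen N 0) ^ n) (lp.single 2 k x) =
      lp.single 2 (k + n) ((star (S N 0) ^ n) x) := by
  have h := laurentRep_star_genWord_single hN (List.replicate n (0 : Fin N)) k x
  simpa [genWord, word] using h

/-- The terms of a Fourier expansion as elements of `O_N`. -/
theorem exists_fourierTerm (hN : 2 ≤ N) (k : ℤ) {a : H →L[ℂ] H} (ha : a ∈ parAlg N) :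
    ∃ A : cuntzAlg N, (A : H →L[ℂ] H) = fourierTerm N k a ∧
      laurentEntry hN 0 0 A = if k = 0 then a else 0 := by
  let a' : cuntzAlg N := ⟨a, parAlg_le_cuntzAlg ha⟩
  have hπ : laurentRep hN a' = diagOp ℤ a := laurentRep_of_mem_parAlg hN (A := a') ha
  by_cases hk : k < 0
  · refine ⟨star (gen N 0) ^ (-k).toNat * a', ?_, ?_⟩
    · rw [fourierTerm, if_pos hk]
      rfl
    · ext1 x
      rw [laurentEntry_apply, map_mul, mul_apply_eq_comp, hπ, diagOp_single,
        laurentRep_star_gen_pow_single, lp.single_apply_ne _ _ _ (by omega),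
        if_neg (by omega), zero_apply]
  · refine ⟨a' * gen N 0 ^ k.toNat, ?_, ?_⟩
    · rw [fourierTerm, if_neg hk]
      rfl
    · ext1 x
      rw [laurentEntry_apply, map_mul, mul_apply_eq_comp, laurentRep_gen_pow_single, hπ,
        diagOp_single]
      split_ifs with h
      · subst h
        simp
      · rw [lp.single_apply_ne _ _ _ (by omega), zero_apply]

/-- `π` is block diagonal on `O_N^par`, and the `k`-th term of an expansion displaces positions by
`-k`. Only the zeroth term reaches the block at `(0, 0)`. -/
theorem isZerothCoeff_laurentEntry (hN : 2 ≤ N) : IsZerothCoeff N (laurentEntry hN 0 0) := by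
  intro A s a h0 ha hA
  choose T hT hT' using fun k => exists_fourierTerm hN k (ha k)
  have hA' : A = ∑ k ∈ s, T k := by
    apply Subtype.ext
    rw [hA, AddSubmonoidClass.coe_finsetSum]
    exact Finset.sum_congr rfl fun k _ => (hT k).symm
  rw [hA', map_sum, Finset.sum_congr rfl fun k _ => hT' k, Finset.sum_ite_eq' s 0 a, if_pos h0]

theorem star_S_pow_mul_S_pow (n : ℕ) : star (S N 0) ^ n * S N 0 ^ n = 1 := by
  induction n with
  | zero => simp
  | succ n ih =>
    rw [pow_succ, pow_succ', mul_assoc, ← mul_assoc (star (S N 0)) (S N 0), star_S_mul_S_self,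
      one_mul, ih]

/-- The shorter word is padded with zeros to the length of the longer one; `(S_0^*)^n S_0^n = 1`
undoes the padding. -/
theorem exists_wordPair_eq_fourierTerm (l m : List (Fin N)) :
    ∃ (k : ℤ) (a : H →L[ℂ] H), a ∈ parAlg N ∧ (wordPair l m : H →L[ℂ] H) = fourierTerm N k a := by
  have hw : ∀ n : ℕ, word N (List.replicate n 0) = S N 0 ^ n := fun n => by simp [word]
  by_cases h : l.length < m.length
  · refine ⟨l.length - m.length,
      word N (List.replicate (m.length - l.length) 0 ++ l) * star (word N m),
      word_mul_star_word_mem_parAlg (by simp; omega), ?_⟩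
    have h1 : (-((l.length : ℤ) - m.length)).toNat = m.length - l.length := by omega
    rw [fourierTerm, if_pos (by omega), h1, coe_wordPair, word_append, hw, ← mul_assoc,
      ← mul_assoc, star_S_pow_mul_S_pow, one_mul]
  · refine ⟨l.length - m.length,
      word N l * star (word N (List.replicate (l.length - m.length) 0 ++ m)),
      word_mul_star_word_mem_parAlg (by simp; omega), ?_⟩
    have h1 : ((l.length : ℤ) - m.length).toNat = l.length - m.length := by omega
    rw [fourierTerm, if_neg (by omega), h1, coe_wordPair, word_append, hw, star_mul, star_pow,
      mul_assoc, mul_assoc, star_S_pow_mul_S_pow, mul_one]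

theorem IsZerothCoeff.unique {Φ Ψ : cuntzAlg N →L[ℂ] (H →L[ℂ] H)} (hΦ : IsZerothCoeff N Φ)
    (hΨ : IsZerothCoeff N Ψ) : Φ = Ψ := by
  refine clm_ext_of_wordPair fun l m => ?_
  obtain ⟨k, a, ha, h⟩ := exists_wordPair_eq_fourierTerm l m
  have ha' : ∀ j, (Pi.single k a : ℤ → (H →L[ℂ] H)) j ∈ parAlg N := fun j => by
    by_cases hj : j = k
    · subst hj
      rwa [Pi.single_eq_same]
    · rw [Pi.single_eq_of_ne hj]
      exact zero_mem _
  -- The index `0` is included because `IsZerothCoeff` demands it; for `k ≠ 0` its coefficient is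
  -- `0`.
  have hsum : (wordPair l m : H →L[ℂ] H) =
      ∑ j ∈ ({0, k} : Finset ℤ), fourierTerm N j ((Pi.single k a : ℤ → (H →L[ℂ] H)) j) := by
    rw [Finset.sum_eq_single k, Pi.single_eq_same, h]
    · intro j _ hj
      rw [Pi.single_eq_of_ne hj, fourierTerm]
      simp
    · simp
  rw [hΦ _ _ _ (by simp) ha' hsum, hΨ _ _ _ (by simp) ha' hsum]

theorem isZerothCoeff_expectation (hN : 2 ≤ N) : IsZerothCoeff N (expectation N) := by
  have h : ∃ Φ, IsZerothCoeff N Φ := ⟨_, isZerothCoeff_laurentEntry hN⟩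
  rw [expectation, dif_pos h]
  exact h.choose_spec

theorem expectation_eq (hN : 2 ≤ N) : expectation N = laurentEntry hN 0 0 :=
  (isZerothCoeff_expectation hN).unique (isZerothCoeff_laurentEntry hN)

/-- The factors `S_0^i` and `(S_0^*)^j` around `A` move the `(i, j)` block of `π(A)` to position
`(0, 0)`; the outer factors in `Ψ` then cancel the powers of `S_0` that it has acquired. -/
theorem psiMatrix_eq (hN : 2 ≤ N) (A : cuntzAlg N) (i j : ℕ) :
    psiMatrix N A i j = laurentEntry hN i j A := by
  have h : laurentEntry hN 0 0 (gen N 0 ^ i * A * star (gen N 0) ^ j) =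
      S N 0 ^ i * laurentEntry hN i j A * star (S N 0) ^ j := by
    ext1 x
    rw [laurentEntry_apply, map_mul, map_mul, mul_apply_eq_comp, mul_apply_eq_comp,
      laurentRep_star_gen_pow_single, mul_apply_eq_comp, mul_apply_eq_comp, laurentEntry_apply,
      zero_add]
    generalize laurentRep hN A _ = y
    have h2 : lp.evalCLM ℂ (fun _ : ℤ => H) 2 0 ∘L laurentRep hN (gen N 0 ^ i) =
        (S N 0 ^ i) ∘L lp.evalCLM ℂ (fun _ : ℤ => H) 2 (i : ℤ) := by
      refine L2.clm_ext fun k a => ?_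
      change laurentRep hN (gen N 0 ^ i) (lp.single 2 k a) 0 =
        (S N 0 ^ i) ((lp.single 2 k a : HZ) i)
      rw [laurentRep_gen_pow_single, lp.single_apply, lp.single_apply]
      by_cases hk : (i : ℤ) = k
      · subst hk
        simp
      · rw [Pi.single_eq_of_ne hk, Pi.single_eq_of_ne (by omega), map_zero]
    exact congrArg (fun f : HZ →L[ℂ] H => f y) h2
  rw [psiMatrix, expectation_eq hN, h, mul_assoc, mul_assoc, mul_assoc, star_S_pow_mul_S_pow,
    mul_one, ← mul_assoc, star_S_pow_mul_S_pow, one_mul]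

theorem toeplitzMatrix_symb (hN : 2 ≤ N) (A : cuntzAlg N) (i j : ℕ) :
    toeplitzMatrix (symb N A) i j = laurentEntry hN i j A :=
  coeff_symb hN A i j

/-- The Toeplitz operator of an element of `O_N` as a compression of its Laurent operator. -/
def toeplitzCompression (hN : 2 ≤ N) : cuntzAlg N →L[ℂ] (HH →L[ℂ] HH) :=
  (ContinuousLinearMap.compL ℂ HH HZ HH (ContinuousLinearMap.adjoint incl)) ∘L
    ((ContinuousLinearMap.compL ℂ HH HZ HZ).flip incl) ∘L laurentRepL hN

theorem toeplitzCompression_apply (hN : 2 ≤ N) (A : cuntzAlg N) (x : HH) :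
    toeplitzCompression hN A x =
      ContinuousLinearMap.adjoint incl (laurentRep hN A (incl x)) := rfl

theorem hasBlockMatrix_toeplitzCompression (hN : 2 ≤ N) (A : cuntzAlg N) :
    HasBlockMatrix (toeplitzCompression hN A) fun i j => laurentEntry hN i j A := by
  intro i j x
  rw [toeplitzCompression_apply, adjoint_incl_apply, incl_single, laurentEntry_apply]

theorem HasBlockMatrix.unique {T T' : HH →L[ℂ] HH} {M : ℕ → ℕ → (H →L[ℂ] H)}
    (h : HasBlockMatrix T M) (h' : HasBlockMatrix T' M) : T = T' :=
  L2.clm_ext fun j x => by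
    ext i : 2
    rw [h, h']

theorem HasBlockMatrix.blockOp_eq {T : HH →L[ℂ] HH} {M : ℕ → ℕ → (H →L[ℂ] H)}
    (h : HasBlockMatrix T M) : blockOp M = T := by
  have h' : ∃ T, HasBlockMatrix T M := ⟨T, h⟩
  rw [blockOp, dif_pos h']
  exact h'.choose_spec.unique h

theorem toeplitzOp_symb (hN : 2 ≤ N) (A : cuntzAlg N) :
    toeplitzOp (symb N A) = toeplitzCompression hN A := by
  have h : toeplitzMatrix (symb N A) = fun i j : ℕ => laurentEntry hN i j A := by
    funext i j
    exact toeplitzMatrix_symb hN A i j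
  rw [toeplitzOp, h]
  exact (hasBlockMatrix_toeplitzCompression hN A).blockOp_eq

theorem psi_eq (hN : 2 ≤ N) (A : cuntzAlg N) : psi N A = toeplitzCompression hN A := by
  have h : psiMatrix N A = fun i j : ℕ => laurentEntry hN i j A := by
    funext i j
    exact psiMatrix_eq hN A i j
  rw [psi, h]
  exact (hasBlockMatrix_toeplitzCompression hN A).blockOp_eq

theorem hasBlockMatrix_toeplitzOp_symb (hN : 2 ≤ N) (A : cuntzAlg N) :
    HasBlockMatrix (toeplitzOp (symb N A)) (toeplitzMatrix (symb N A)) := by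
  rw [toeplitzOp_symb hN]
  intro i j x
  rw [toeplitzMatrix_symb hN]
  exact hasBlockMatrix_toeplitzCompression hN A i j x

theorem hasBlockMatrix_psi (hN : 2 ≤ N) (A : cuntzAlg N) :
    HasBlockMatrix (psi N A) (psiMatrix N A) := by
  rw [psi_eq hN]
  intro i j x
  rw [psiMatrix_eq hN]
  exact hasBlockMatrix_toeplitzCompression hN A i j x

end Expectation

/-! ### The Toeplitz algebra, its symbol map and the ideal `C_N` -/

section ToeplitzAlgebra

variable {N : ℕ} [NeZero N]

theorem toeplitzCompression_one (hN : 2 ≤ N) : toeplitzCompression hN 1 = 1 := by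
  ext1 x
  rw [toeplitzCompression_apply, map_one, one_apply_eq_self, adjoint_incl_incl]
  rfl

theorem Sig_mul_toeplitzCompression (hN : 2 ≤ N) (i : Fin N) (A : cuntzAlg N) :
    Sig N i * toeplitzCompression hN A = toeplitzCompression hN (gen N i * A) := by
  ext1 x
  rw [mul_apply_eq_comp, toeplitzCompression_apply, toeplitzCompression_apply, Sig_adjoint_incl,
    map_mul, laurentRep_gen, mul_apply_eq_comp]

theorem star_Sig_mul_toeplitzCompression (hN : 2 ≤ N) (i : Fin N) (A : cuntzAlg N) :
    star (Sig N i) * toeplitzCompression hN A =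
      (1 - Pi1) * toeplitzCompression hN (star (gen N i) * A) := by
  ext1 x
  rw [mul_apply_eq_comp, mul_apply_eq_comp, toeplitzCompression_apply, toeplitzCompression_apply,
    star_Sig_adjoint_incl, map_mul, map_star, laurentRep_gen, mul_apply_eq_comp]

theorem toeplitzCompression_star (hN : 2 ≤ N) (A : cuntzAlg N) :
    toeplitzCompression hN (star A) = star (toeplitzCompression hN A) := by
  rw [ContinuousLinearMap.star_eq_adjoint, ContinuousLinearMap.eq_adjoint_iff]
  intro x y
  rw [toeplitzCompression_apply, toeplitzCompression_apply, map_star,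
    ContinuousLinearMap.adjoint_inner_left, ContinuousLinearMap.star_eq_adjoint,
    ContinuousLinearMap.adjoint_inner_left, ContinuousLinearMap.adjoint_inner_right]

/-- The word `Σ_l` in the operators `Σ_i`. -/
def sigWord (N : ℕ) [NeZero N] (l : List (Fin N)) : HH →L[ℂ] HH := (l.map (Sig N)).prod

theorem toeplitzCompression_genWord_mul (hN : 2 ≤ N) (l : List (Fin N)) (A : cuntzAlg N) :
    toeplitzCompression hN (genWord N l * A) = sigWord N l * toeplitzCompression hN A := by
  induction l with
  | nil => simp [genWord_nil, sigWord]
  | cons i l ih =>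
    rw [genWord_cons, mul_assoc, ← Sig_mul_toeplitzCompression, ih, ← mul_assoc]
    simp [sigWord]

/-- Compression is multiplicative for a left factor `S_l` and respects adjoints; in `S_l S_m^*` the
factors stand in the favourable order, so no defect appears. -/
theorem toeplitzCompression_wordPair (hN : 2 ≤ N) (l m : List (Fin N)) :
    toeplitzCompression hN (wordPair l m) = sigWord N l * star (sigWord N m) := by
  have h := toeplitzCompression_genWord_mul hN m 1
  rw [mul_one, toeplitzCompression_one, mul_one] at h
  rw [wordPair, toeplitzCompression_genWord_mul, toeplitzCompression_star, h]

theorem isClosed_toepAlg : IsClosed (toepAlg N : Set (HH →L[ℂ] HH)) :=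
  StarSubalgebra.isClosed_topologicalClosure _

theorem Sig_mem_toepAlg (i : Fin N) : Sig N i ∈ toepAlg N :=
  StarSubalgebra.le_topologicalClosure _ (StarAlgebra.subset_adjoin ℂ _ ⟨i, rfl⟩)

theorem sigWord_mem_toepAlg (l : List (Fin N)) : sigWord N l ∈ toepAlg N := by
  refine list_prod_mem ?_
  simp only [List.mem_map]
  rintro _ ⟨i, -, rfl⟩
  exact Sig_mem_toepAlg i

theorem toeplitzCompression_mem_toepAlg (hN : 2 ≤ N) (A : cuntzAlg N) :
    toeplitzCompression hN A ∈ toepAlg N := by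
  refine mem_of_wordPair_mem (Q := (toepAlg N).toSubalgebra.toSubmodule.comap
    (toeplitzCompression hN).toLinearMap)
    (isClosed_toepAlg.preimage (toeplitzCompression hN).continuous) (fun l m => ?_) A
  change toeplitzCompression hN (wordPair l m) ∈ toepAlg N
  rw [toeplitzCompression_wordPair]
  exact mul_mem (sigWord_mem_toepAlg l) (star_mem (sigWord_mem_toepAlg m))

theorem asympIntertwines_sigWord (hN : 2 ≤ N) (l : List (Fin N)) :
    AsympIntertwines truncOp (sigWord N l) (laurentRep hN (genWord N l)) := by
  induction l with
  | nil =>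
    rw [genWord_nil, map_one]
    exact AsympIntertwines.one
  | cons i l ih =>
    have h : sigWord N (i :: l) = Sig N i * sigWord N l := by simp [sigWord]
    rw [genWord_cons, map_mul, laurentRep_gen, h]
    exact (asympIntertwines_truncOp N i).mul ih

theorem asympIntertwines_toeplitzCompression (hN : 2 ≤ N) (A : cuntzAlg N) :
    AsympIntertwines truncOp (toeplitzCompression hN A) (laurentRep hN A) := by
  let Q : Submodule ℂ (cuntzAlg N) :=
    { carrier := {A | AsympIntertwines truncOp (toeplitzCompression hN A) (laurentRep hN A)}
      add_mem' := fun {A B} hA hB => by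
        change AsympIntertwines _ _ _
        rw [map_add, map_add]
        exact AsympIntertwines.add hA hB
      zero_mem' := by
        change AsympIntertwines _ _ _
        rw [map_zero, map_zero]
        constructor <;> intro x <;> simp
      smul_mem' := fun c A hA => by
        change AsympIntertwines _ _ _
        rw [map_smul, map_smul]
        exact AsympIntertwines.smul c hA }
  refine mem_of_wordPair_mem (Q := Q) (isClosed_of_closure_subset fun B hB => ?_)
    (fun l m => ?_) A
  · obtain ⟨u, hu, hlim⟩ := mem_closure_iff_seq_limit.1 hB
    exact AsympIntertwines.of_tendsto asympIsometric_truncOp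
      (((toeplitzCompression hN).continuous.tendsto B).comp hlim)
      (((continuous_laurentRep hN).tendsto B).comp hlim) hu
  · change AsympIntertwines _ _ _
    rw [toeplitzCompression_wordPair, wordPair, map_mul, map_star]
    exact (asympIntertwines_sigWord hN l).mul (asympIntertwines_sigWord hN m).adjoint

theorem norm_le_norm_toeplitzCompression (hN : 2 ≤ N) (A : cuntzAlg N) :
    ‖A‖ ≤ ‖toeplitzCompression hN A‖ := by
  rw [← norm_laurentRep hN]
  exact (asympIntertwines_toeplitzCompression hN A).norm_le asympIsometric_truncOp

theorem norm_toeplitzCompression_le (hN : 2 ≤ N) (A : cuntzAlg N) :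
    ‖toeplitzCompression hN A‖ ≤ ‖A‖ := by
  refine ContinuousLinearMap.opNorm_le_bound _ (norm_nonneg _) fun x => ?_
  rw [toeplitzCompression_apply]
  refine (norm_adjoint_incl_le _).trans ((ContinuousLinearMap.le_opNorm _ _).trans ?_)
  rw [norm_incl, norm_laurentRep]

theorem isClosed_range_toeplitzCompression (hN : 2 ≤ N) :
    IsClosed (LinearMap.range (toeplitzCompression hN).toLinearMap : Set (HH →L[ℂ] HH)) := by
  have h : AntilipschitzWith 1 (toeplitzCompression hN) :=
    AddMonoidHomClass.antilipschitz_of_bound _ fun A => by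
      simpa using norm_le_norm_toeplitzCompression hN A
  exact h.isClosed_range (toeplitzCompression hN).uniformContinuous

theorem exists_symbolHom (N : ℕ) [NeZero N] : ∃ W : toepAlg N →⋆ₐ[ℂ] (HZ →L[ℂ] HZ),
    ∀ B : toepAlg N, AsympIntertwines truncOp (B : HH →L[ℂ] HH) (W B) :=
  exists_starAlgHom_asympIntertwines asympIsometric_truncOp (G := Set.range (Sig N)) (by
    rintro _ ⟨i, rfl⟩
    exact ⟨_, asympIntertwines_truncOp N i⟩)

theorem isClosed_range_laurentRep (hN : 2 ≤ N) :
    IsClosed ((laurentRep hN).range : Set (HZ →L[ℂ] HZ)) := by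
  have h : AntilipschitzWith 1 (laurentRep hN) :=
    AddMonoidHomClass.antilipschitz_of_bound _ fun A => by
      rw [norm_laurentRep]
      simp
  have hu : UniformContinuous (laurentRep hN) := (laurentRepL hN).uniformContinuous
  exact h.isClosed_range hu

/-- `W(Σ_i) = π(S_i)`, and the range of the isometric `π` is closed. -/
theorem symbolHom_mem_range (hN : 2 ≤ N) {W : toepAlg N →⋆ₐ[ℂ] (HZ →L[ℂ] HZ)}
    (hW : ∀ B : toepAlg N, AsympIntertwines truncOp (B : HH →L[ℂ] HH) (W B)) (B : toepAlg N) :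
    ∃ A, laurentRep hN A = W B := by
  refine starAlgHom_mem_of_generators (G := Set.range (Sig N)) W
    (continuous_of_asympIntertwines asympIsometric_truncOp hW) (isClosed_range_laurentRep hN) ?_ B
  rintro _ ⟨i, rfl⟩
  exact ⟨gen N i, (laurentRep_gen hN i).trans ((asympIntertwines_truncOp N i).unique
    asympIsometric_truncOp (hW ⟨Sig N i, Sig_mem_toepAlg i⟩))⟩

theorem star_Pi1 : star Pi1 = Pi1 := by
  have h : Pi1 = 1 - fshift * star fshift := by rw [fshift_mul_star_fshift, sub_sub_cancel]
  rw [h, star_sub, star_one, star_mul, star_star]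

theorem asympIntertwines_Pi1 : AsympIntertwines truncOp Pi1 0 := by
  have h : ∀ y, Tendsto (fun n => Pi1 (truncOp n y) - truncOp n ((0 : HZ →L[ℂ] HZ) y)) atTop
      (𝓝 0) := fun y => by simpa using tendsto_Pi1_truncOp y
  exact ⟨h, by rw [star_Pi1, star_zero]; exact h⟩

theorem star_Sig_mul_Sig (i : Fin N) : star (Sig N i) * Sig N i = 1 - Pi1 := by
  have h : Sig N i = diagOp ℕ (S N i) * star fshift := rfl
  rw [star_Sig, h, mul_assoc, ← mul_assoc (diagOp ℕ _), ← diagOp_mul, star_S_mul_S_self,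
    ← fshift_mul_star_fshift]
  rfl

theorem Pi1_mem_toepAlg : Pi1 ∈ toepAlg N := by
  have h : Pi1 = 1 - star (Sig N 0) * Sig N 0 := by rw [star_Sig_mul_Sig, sub_sub_cancel]
  rw [h]
  exact sub_mem (one_mem _) (mul_mem (star_mem (Sig_mem_toepAlg 0)) (Sig_mem_toepAlg 0))

theorem isClosedIdeal_idealC : IsClosedIdeal N (idealC N) := by
  refine ⟨fun x hx => ?_, ?_, fun a ha x hx => ?_⟩
  · refine (Submodule.mem_sInf.1 hx) (toepAlg N).toSubalgebra.toSubmodule ⟨⟨fun _ h => h,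
      isClosed_toepAlg, fun a ha x hx =>
        ⟨(toepAlg N).mul_mem ha hx, (toepAlg N).mul_mem hx ha⟩⟩, Pi1_mem_toepAlg⟩
  · rw [idealC, Submodule.coe_sInf]
    exact isClosed_biInter fun J hJ => hJ.1.2.1
  · exact ⟨Submodule.mem_sInf.2 fun J hJ => (hJ.1.2.2 a ha x (Submodule.mem_sInf.1 hx J hJ)).1,
      Submodule.mem_sInf.2 fun J hJ => (hJ.1.2.2 a ha x (Submodule.mem_sInf.1 hx J hJ)).2⟩

theorem Pi1_mem_idealC : Pi1 ∈ idealC N := Submodule.mem_sInf.2 fun _ hJ => hJ.2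

/-- The elements of `T_N` with symbol `0` form a closed ideal containing `Π_1`, so minimality of
`C_N` applies. -/
theorem asympIntertwines_zero_of_mem_idealC {B : HH →L[ℂ] HH} (hB : B ∈ idealC N) :
    AsympIntertwines truncOp B 0 := by
  let J : Submodule ℂ (HH →L[ℂ] HH) :=
    { carrier := {x | AsympIntertwines truncOp x 0 ∧ x ∈ toepAlg N}
      add_mem' := fun hx hy => ⟨by simpa using hx.1.add hy.1, add_mem hx.2 hy.2⟩
      zero_mem' := ⟨by constructor <;> intro x <;> simp, zero_mem _⟩
      smul_mem' := fun c x hx => ⟨by simpa using hx.1.smul c, (toepAlg N).smul_mem hx.2 c⟩ }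
  have hJ : IsClosedIdeal N J := by
    refine ⟨fun x hx => hx.2, isClosed_of_closure_subset fun x hx => ?_, fun a ha x hx => ?_⟩
    · obtain ⟨u, hu, hlim⟩ := mem_closure_iff_seq_limit.1 hx
      exact ⟨AsympIntertwines.of_tendsto asympIsometric_truncOp hlim tendsto_const_nhds
        fun n => (hu n).1, isClosed_toepAlg.mem_of_tendsto hlim
          (Eventually.of_forall fun n => (hu n).2)⟩
    · obtain ⟨W, hW⟩ := exists_symbolHom N
      have h := hW ⟨a, ha⟩
      exact ⟨⟨by simpa using h.mul hx.1, mul_mem ha hx.2⟩,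
        ⟨by simpa using hx.1.mul h, mul_mem hx.2 ha⟩⟩
  exact ((Submodule.mem_sInf.1 hB) J ⟨hJ, asympIntertwines_Pi1, Pi1_mem_toepAlg⟩).1

/-- The sum contains `1` and is stable under left multiplication by `Σ_i` and `Σ_i^*`; the latter
costs a term `Π_1 T(S_i^* A)`, which lies in `C_N`. Only the algebra before closure is treated,
since the sum is not yet known to be closed. -/
theorem adjoin_Sig_le (hN : 2 ≤ N) {B : HH →L[ℂ] HH}
    (hB : B ∈ StarAlgebra.adjoin ℂ (Set.range (Sig N))) :
    B ∈ LinearMap.range (toeplitzCompression hN).toLinearMap ⊔ idealC N := by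
  have hC := isClosedIdeal_idealC (N := N)
  refine adjoin_le_of_mul_mem
    (LinearMap.range (toeplitzCompression hN).toLinearMap ⊔ idealC N)
    (Submodule.mem_sup_left ⟨1, toeplitzCompression_one hN⟩) ?_ hB
  rintro _ ⟨i, rfl⟩ x hx
  obtain ⟨_, ⟨A, rfl⟩, c, hc, rfl⟩ := Submodule.mem_sup.1 hx
  rw [mul_add, mul_add]
  refine ⟨Submodule.add_mem_sup ⟨gen N i * A, (Sig_mul_toeplitzCompression hN i A).symm⟩
    (hC.2.2 _ (Sig_mem_toepAlg i) c hc).1, ?_⟩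
  have h : star (Sig N i) * toeplitzCompression hN A =
      toeplitzCompression hN (star (gen N i) * A) +
        -(Pi1 * toeplitzCompression hN (star (gen N i) * A)) := by
    rw [star_Sig_mul_toeplitzCompression, sub_mul, one_mul, sub_eq_add_neg]
  change star (Sig N i) * toeplitzCompression hN A + _ ∈ _
  rw [h, add_assoc]
  exact Submodule.add_mem_sup ⟨star (gen N i) * A, rfl⟩ (add_mem
    (neg_mem (hC.2.2 _ (toeplitzCompression_mem_toepAlg hN _) _ Pi1_mem_idealC).2)
    (hC.2.2 _ (star_mem (Sig_mem_toepAlg i)) c hc).1)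

theorem mem_idealC_of_asympIntertwines_zero (hN : 2 ≤ N) {B : HH →L[ℂ] HH} (hB : B ∈ toepAlg N)
    (hB0 : AsympIntertwines truncOp B 0) : B ∈ idealC N := by
  obtain ⟨p, hp, hlim⟩ := mem_closure_iff_seq_limit.1 hB
  have hex : ∀ n, ∃ A : cuntzAlg N, p n - toeplitzCompression hN A ∈ idealC N := fun n => by
    obtain ⟨_, ⟨A, rfl⟩, c, hc, h⟩ := Submodule.mem_sup.1 (adjoin_Sig_le hN (hp n))
    refine ⟨A, ?_⟩
    rw [← h]
    change toeplitzCompression hN A + c - toeplitzCompression hN A ∈ _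
    rwa [add_sub_cancel_left]
  choose A hA using hex
  -- Both `p n - T(A n)` and `B` have symbol `0`, so `p n - B` has symbol `π(A n)`, whose norm is
  -- `‖A n‖`. Hence `T(A n) → 0`, and `B` is the limit of the elements `p n - T(A n)` of `C_N`.
  have hle : ∀ n, ‖toeplitzCompression hN (A n)‖ ≤ ‖p n - B‖ := fun n => by
    have h1 := asympIntertwines_zero_of_mem_idealC (hA n)
    have h2 := (h1.add (asympIntertwines_toeplitzCompression hN (A n))).sub hB0
    rw [sub_add_cancel, zero_add, sub_zero] at h2
    have h3 := h2.norm_le asympIsometric_truncOp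
    rw [norm_laurentRep] at h3
    exact (norm_toeplitzCompression_le hN (A n)).trans h3
  have h0 : Tendsto (fun n => toeplitzCompression hN (A n)) atTop (𝓝 0) :=
    squeeze_zero_norm hle (by simpa using (hlim.sub_const B).norm)
  have h1 := hlim.sub h0
  rw [sub_zero] at h1
  exact isClosedIdeal_idealC.2.1.mem_of_tendsto h1 (Eventually.of_forall hA)

theorem disjoint_range_toeplitzCompression_idealC (hN : 2 ≤ N) :
    Disjoint (LinearMap.range (toeplitzCompression hN).toLinearMap) (idealC N) := by
  rw [Submodule.disjoint_def]
  rintro _ ⟨A, rfl⟩ hA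
  have h1 := (asympIntertwines_toeplitzCompression hN A).unique asympIsometric_truncOp
    (asympIntertwines_zero_of_mem_idealC hA)
  have h2 := norm_laurentRep hN A
  rw [h1, norm_zero, eq_comm, norm_eq_zero] at h2
  rw [h2, map_zero]

theorem range_toeplitzCompression_sup_idealC (hN : 2 ≤ N) :
    LinearMap.range (toeplitzCompression hN).toLinearMap ⊔ idealC N =
      (toepAlg N).toSubalgebra.toSubmodule := by
  refine le_antisymm (sup_le ?_ fun x hx => isClosedIdeal_idealC.1 x hx) fun B hB => ?_
  · rintro _ ⟨A, rfl⟩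
    exact toeplitzCompression_mem_toepAlg hN A
  · have hB' : B ∈ toepAlg N := hB
    obtain ⟨W, hW⟩ := exists_symbolHom N
    -- With `A` chosen so that `π(A) = W(B)`, the remainder `B - T(A)` has symbol `0`.
    obtain ⟨A, hA⟩ := symbolHom_mem_range hN hW ⟨B, hB'⟩
    have h := (hW ⟨B, hB'⟩).sub (asympIntertwines_toeplitzCompression hN A)
    rw [hA, sub_self] at h
    have h2 := mem_idealC_of_asympIntertwines_zero hN
      (sub_mem hB' (toeplitzCompression_mem_toepAlg hN A)) h
    rw [← add_sub_cancel (toeplitzCompression hN A) B]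
    exact Submodule.add_mem_sup ⟨A, rfl⟩ h2

end ToeplitzAlgebra

end StratToeplitz

end

theorem theorem94p22 (N : ℕ) [NeZero N] (hN : 2 ≤ N) :
    -- the automorphisms `ρ_z` and the expectation `Φ₀` are well defined
    (∀ z : Circle, (∃! ρ, StratToeplitz.IsGauge N z ρ) ∧
      StratToeplitz.IsGauge N z (StratToeplitz.gauge N z)) ∧
    (∃! Φ, StratToeplitz.IsZerothCoeff N Φ) ∧ StratToeplitz.IsZerothCoeff N (StratToeplitz.expectation N) ∧
    -- `f_A` is continuous, `T(f_A)` and `Ψ(A)` are bounded operators, and they coincide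
    (∀ A : StratToeplitz.cuntzAlg N,
      Continuous (StratToeplitz.symb N A) ∧
      StratToeplitz.HasBlockMatrix (StratToeplitz.toeplitzOp (StratToeplitz.symb N A))
        (StratToeplitz.toeplitzMatrix (StratToeplitz.symb N A)) ∧
      StratToeplitz.HasBlockMatrix (StratToeplitz.psi N A) (StratToeplitz.psiMatrix N A) ∧
      StratToeplitz.toeplitzOp (StratToeplitz.symb N A) = StratToeplitz.psi N A) ∧
    -- `T_N = {T(f_A)} ⊕ C_N = {Ψ(A)} ⊕ C_N`, with a closed linear subspace `M = {T(f_A)}`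
    (∃ M : Submodule ℂ (StratToeplitz.HH →L[ℂ] StratToeplitz.HH),
      (M : Set (StratToeplitz.HH →L[ℂ] StratToeplitz.HH)) =
        {T | ∃ A : StratToeplitz.cuntzAlg N,
          T = StratToeplitz.toeplitzOp (StratToeplitz.symb N A)} ∧
      (M : Set (StratToeplitz.HH →L[ℂ] StratToeplitz.HH)) =
        {T | ∃ A : StratToeplitz.cuntzAlg N, T = StratToeplitz.psi N A} ∧
      IsClosed (M : Set (StratToeplitz.HH →L[ℂ] StratToeplitz.HH)) ∧
      Disjoint M (StratToeplitz.idealC N) ∧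
      M ⊔ StratToeplitz.idealC N = (StratToeplitz.toepAlg N).toSubalgebra.toSubmodule) ∧
    -- `C_N` is the kernel of the homomorphism `B ↦ s-lim V_n^* B V_n` on `T_N`
    (∃ W : StratToeplitz.toepAlg N →⋆ₐ[ℂ] (StratToeplitz.HZ →L[ℂ] StratToeplitz.HZ),
      (∀ (B : StratToeplitz.toepAlg N) (x : StratToeplitz.HZ),
        Tendsto (fun n : ℕ => StratToeplitz.shifted (B : StratToeplitz.HH →L[ℂ] StratToeplitz.HH) n x)
          atTop (𝓝 (W B x))) ∧
      ∀ B : StratToeplitz.toepAlg N,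
        W B = 0 ↔ (B : StratToeplitz.HH →L[ℂ] StratToeplitz.HH) ∈ StratToeplitz.idealC N) := by
  refine ⟨fun z => ⟨⟨StratToeplitz.gauge N z, StratToeplitz.isGauge_gauge N hN z,
      fun ρ hρ => hρ.unique N (StratToeplitz.isGauge_gauge N hN z)⟩,
      StratToeplitz.isGauge_gauge N hN z⟩,
    ⟨StratToeplitz.expectation N, StratToeplitz.isZerothCoeff_expectation hN,
      fun Φ hΦ => hΦ.unique (StratToeplitz.isZerothCoeff_expectation hN)⟩,
    StratToeplitz.isZerothCoeff_expectation hN,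
    fun A => ⟨StratToeplitz.continuous_symb hN A,
      StratToeplitz.hasBlockMatrix_toeplitzOp_symb hN A, StratToeplitz.hasBlockMatrix_psi hN A,
      (StratToeplitz.toeplitzOp_symb hN A).trans (StratToeplitz.psi_eq hN A).symm⟩,
    ⟨LinearMap.range (StratToeplitz.toeplitzCompression hN).toLinearMap, ?_, ?_,
      StratToeplitz.isClosed_range_toeplitzCompression hN,
      StratToeplitz.disjoint_range_toeplitzCompression_idealC hN,
      StratToeplitz.range_toeplitzCompression_sup_idealC hN⟩, ?_⟩
  · ext T
    refine exists_congr fun A => ?_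
    rw [StratToeplitz.toeplitzOp_symb hN, eq_comm]
    rfl
  · ext T
    refine exists_congr fun A => ?_
    rw [StratToeplitz.psi_eq hN, eq_comm]
    rfl
  · obtain ⟨W, hW⟩ := StratToeplitz.exists_symbolHom N
    refine ⟨W, fun B x => (hW B).tendsto_shifted x, fun B => ⟨fun h => ?_, fun h => ?_⟩⟩
    · have h' := hW B
      rw [h] at h'
      exact StratToeplitz.mem_idealC_of_asympIntertwines_zero hN B.2 h'
    · exact (hW B).unique StratToeplitz.asympIsometric_truncOp
        (StratToeplitz.asympIntertwines_zero_of_mem_idealC h)
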